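/- Let $d\ge 1$, let $v_1,\dots,v_d$ be a basis of $\mathbb{R}^d$, $\Lambda=\mathbb{Z}v_1\oplus\cdots\oplus\mathbb{Z}v_d$, $\mathbb{T}^d=\mathbb{R}^d/\Lambda$ (with Lebesgue measure), and let $\Lambda^*$ be the dual lattice, spanned by the vectors $k_i$ with $k_i\cdot v_j=2\pi\delta_{ij}$. Let $\rho\in L^\infty(\mathbb{T}^d)$ (that is, a bounded $\Lambda$-periodic density on $\mathbb{R}^d$) satisfy $\rho\ge 0$ almost everywhere and not vanish almost everywhere, and let $g,\Omega\in\mathbb{R}$ with $g\neq 0$. For $k\in\mathbb{R}^d$ let $(-(\nabla+ik)^2)^{1/2}$ be the Fourier multiplier $e^{iG\cdot x}\mapsto |G+k|\,e^{iG\cdot x}$, $G\in\Lambda^*$, on $L^2(\mathbb{T}^d)$ with domain $H^1(\mathbb{T}^d)$, and let $$H(k)=\begin{pmatrix}(-(\nabla+ik)^2)^{1/2} & g\sqrt{\rho}\\ g\sqrt{\rho} & \Omega\end{pmatrix}$$ on $L^2(\mathbb{T}^d;\mathbb{C}^2)$ with domain $H^1(\mathbb{T}^d)\times L^2(\mathbb{T}^d)$.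 Then, for every $k\in\mathbb{R}^d$, the spectrum $\sigma(H(k))$ is real and is discrete away from $\Omega$: every point of $\sigma(H(k))\setminus\{\Omega\}$ is an isolated point of the spectrum and an eigenvalue of finite multiplicity. Moreover there are real sequences $(\omega_j^+(k))_{j\ge1}$ and $(\omega_j^-(k))_{j\ge1}$ (eigenvalues repeated according to multiplicity) such that: 1. $\sigma(H(k))\cap(\Omega,\infty)=\{\omega_j^+(k): j\ge 1\}$, with $0\le\omega_1^+(k)\le\omega_2^+(k)\le\cdots$ and $\lim_{j\to\infty}\omega_j^+(k)=\infty$. 2. $\sigma(H(k))\cap(-\infty,\Omega)=\{\omega_j^-(k): j\ge 1\}$, with $\omega_1^-(k)\le\omega_2^-(k)\le\cdots$ and $\lim_{j\to\infty}\omega_j^-(k)=\Omega$. 3. The eigenvectors of $H(k)$ form a basis of $L^2(\mathbb{T}^d;\mathbb{C}^2)$: there is an orthonormal Hilbert basis consisting of one eigenvector for each $\omega_j^+(k)$, one eigenvector for each $\omega_j^-(k)$, and eigenvectors of $H(k)$ with eigenvalue $\Omega$. If $\rho>0$ almost everywhere, there are none of the last kind, so the eigenvectors for the $\omega_j^\pm(k)$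 alone form the basis. -/

import Mathlib

open MeasureTheory
open scoped ENNReal

noncomputable section

namespace Bloch

/-! ### Spectral notions for unbounded operators -/

/-- The resolvent set of an unbounded operator `T`: those `z` for which `T - z` is a bijection of
the domain of `T` onto the whole space with bounded inverse `R`. -/
def resolventSet {X : Type*} [NormedAddCommGroup X] [NormedSpace ℂ X] (T : X →ₗ.[ℂ] X) : Set ℂ :=
  {z | ∃ R : X →L[ℂ] X,
    (∀ x : X, ∃ h : R x ∈ T.domain, T ⟨R x, h⟩ - z • R x = x) ∧
    ∀ y : T.domain, R (T y - z • (y : X)) = y}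

/-- The spectrum of an unbounded operator. -/
def spectrum {X : Type*} [NormedAddCommGroup X] [NormedSpace ℂ X] (T : X →ₗ.[ℂ] X) : Set ℂ :=
  (resolventSet T)ᶜ

/-- The space of all `x` in the domain of `T` with `T x = z • x`. -/
def eigenspace {X : Type*} [NormedAddCommGroup X] [NormedSpace ℂ X] (T : X →ₗ.[ℂ] X) (z : ℂ) :
    Submodule ℂ X :=
  (LinearMap.ker (T.toFun - z • T.domain.subtype)).map T.domain.subtype

/-- `z` is an isolated point of the spectrum of `T` and an eigenvalue of finite multiplicity. -/
def IsDiscreteEigenvalue {X : Type*} [NormedAddCommGroup X] [NormedSpace ℂ X] (T : X →ₗ.[ℂ] X)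
    (z : ℂ) : Prop :=
  z ∈ spectrum T ∧ (∃ ε > 0, ∀ w ∈ spectrum T, w ≠ z → ε ≤ dist w z) ∧
    eigenspace T z ≠ ⊥ ∧ FiniteDimensional ℂ (eigenspace T z)

/-- The domain `{x | ∑ |aₙ ⟨eₙ, x⟩|² < ∞}` of the diagonal operator with entries `aₙ` with respect
to the Hilbert basis `e`. -/
def diagonalDomain {ι X : Type*} [NormedAddCommGroup X] [InnerProductSpace ℂ X]
    (e : HilbertBasis ι ℂ X) (a : ι → ℝ) : Submodule ℂ X where
  carrier := {x | Memℓp (fun n => (a n : ℂ) * inner ℂ (e n) x) 2}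
  zero_mem' := by
    have h : (fun n => (a n : ℂ) * inner ℂ (e n) (0 : X)) = 0 := by ext; simp
    rw [Set.mem_ofPred_eq, h]
    exact zero_memℓp
  add_mem' := by
    intro x y hx hy
    have h : (fun n => (a n : ℂ) * inner ℂ (e n) (x + y)) =
        (fun n => (a n : ℂ) * inner ℂ (e n) x) + fun n => (a n : ℂ) * inner ℂ (e n) y := by
      ext; simp [mul_add]
    rw [Set.mem_ofPred_eq, h]
    exact Memℓp.add hx hy
  smul_mem' := by
    intro c x hx
    have h : (fun n => (a n : ℂ) * inner ℂ (e n) (c • x)) =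
        c • fun n => (a n : ℂ) * inner ℂ (e n) x := by
      ext; simp [mul_left_comm]
    rw [Set.mem_ofPred_eq, h]
    exact Memℓp.const_smul hx c

/-- The (maximal) diagonal operator `x ↦ ∑ aₙ ⟨eₙ, x⟩ eₙ` with respect to a Hilbert basis `e`. -/
def diagonalOperator {ι X : Type*} [NormedAddCommGroup X] [InnerProductSpace ℂ X]
    (e : HilbertBasis ι ℂ X) (a : ι → ℝ) : X →ₗ.[ℂ] X where
  domain := diagonalDomain e a
  toFun :=
    { toFun := fun x => e.repr.symm
        (⟨fun n => (a n : ℂ) * inner ℂ (e n) (x : X), x.2⟩ : lp (fun _ : ι => ℂ) 2)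
      map_add' := by
        intro x y
        rw [← map_add]
        congr 1
        ext n
        simp only [Submodule.coe_add, inner_add_right, mul_add]
        rfl
      map_smul' := by
        intro c x
        rw [RingHom.id_apply, ← map_smul]
        congr 1
        ext n
        simp [mul_left_comm] }

/-! ### Lattice, torus and plane waves -/

/-- `ℝᵈ` with its Euclidean structure. -/
abbrev Space (d : ℕ) : Type := EuclideanSpace ℝ (Fin d)

/-- The lattice `Λ = ℤv₁ ⊕ ⋯ ⊕ ℤv_d`. -/
abbrev lattice {d : ℕ} (v : Module.Basis (Fin d) ℝ (Space d)) : Submodule ℤ (Space d) :=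
  Submodule.span ℤ (Set.range v)

/-- The torus `𝕋ᵈ = ℝᵈ/Λ`. -/
abbrev Torus {d : ℕ} (v : Module.Basis (Fin d) ℝ (Space d)) : Type := Space d ⧸ lattice v

/-- Lebesgue measure on the torus: integration over `𝕋ᵈ` is integration over the fundamental cell
`{∑ θᵢvᵢ | 0 ≤ θᵢ < 1}`. -/
def torusMeasure {d : ℕ} (v : Module.Basis (Fin d) ℝ (Space d)) : Measure (Torus v) :=
  (volume.restrict (ZSpan.fundamentalDomain v)).map Submodule.Quotient.mk

/-- The volume of the torus. -/
def cellVolume {d : ℕ} (v : Module.Basis (Fin d) ℝ (Space d)) : ℝ :=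
  volume.real (ZSpan.fundamentalDomain v)

/-- The reciprocal vectors `kᵢ`, determined by `kᵢ · vⱼ = 2πδᵢⱼ`. -/
def reciprocalVector {d : ℕ} (v : Module.Basis (Fin d) ℝ (Space d)) (i : Fin d) : Space d :=
  (2 * Real.pi) • (InnerProductSpace.toDual ℝ (Space d)).symm
    (LinearMap.toContinuousLinearMap (v.coord i))

lemma inner_reciprocalVector {d : ℕ} (v : Module.Basis (Fin d) ℝ (Space d)) (i : Fin d)
    (x : Space d) : inner ℝ (reciprocalVector v i) x = 2 * Real.pi * v.repr x i := by
  simp [reciprocalVector, real_inner_smul_left]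

/-- The vector `∑ nᵢkᵢ` of the dual lattice `Λ* = ℤk₁ ⊕ ⋯ ⊕ ℤk_d`. -/
def dualVector {d : ℕ} (v : Module.Basis (Fin d) ℝ (Space d)) (n : Fin d → ℤ) : Space d :=
  ∑ i, (n i : ℝ) • reciprocalVector v i

lemma inner_dualVector {d : ℕ} (v : Module.Basis (Fin d) ℝ (Space d)) (n : Fin d → ℤ)
    (x : Space d) : inner ℝ (dualVector v n) x = 2 * Real.pi * ∑ i, n i * v.repr x i := by
  simp only [dualVector, sum_inner, real_inner_smul_left, inner_reciprocalVector, Finset.mul_sum]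
  exact Finset.sum_congr rfl fun i _ => by ring

lemma exists_int_of_mem_lattice {d : ℕ} (v : Module.Basis (Fin d) ℝ (Space d)) {x : Space d}
    (hx : x ∈ lattice v) (i : Fin d) : ∃ m : ℤ, (m : ℝ) = v.repr x i := by
  have := (v.mem_span_iff_repr_mem ℤ x).1 hx i
  simpa using this

/-- The plane wave `x ↦ exp(i G·x)` on the torus, for `G = ∑ nᵢkᵢ` in the dual lattice. -/
def planeWave {d : ℕ} (v : Module.Basis (Fin d) ℝ (Space d)) (n : Fin d → ℤ) : Torus v → ℂ :=
  Quotient.lift (fun x => Complex.exp (Complex.I * (inner ℝ (dualVector v n) x : ℝ))) (by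
    intro x y hxy
    have hxy : x - y ∈ lattice v := (Submodule.quotientRel_def _).1 hxy
    choose m hm using exists_int_of_mem_lattice v hxy
    rw [Complex.exp_eq_exp_iff_exists_int]
    refine ⟨∑ i, n i * m i, ?_⟩
    have h : inner ℝ (dualVector v n) x = inner ℝ (dualVector v n) y
        + (∑ i, n i * m i : ℝ) * (2 * Real.pi) := by
      rw [← sub_eq_iff_eq_add', ← inner_sub_right, inner_dualVector]
      simp only [hm]
      ring
    rw [h]
    push_cast
    ring)

lemma planeWave_mk {d : ℕ} (v : Module.Basis (Fin d) ℝ (Space d)) (n : Fin d → ℤ) (x : Space d) :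
    planeWave v n (Submodule.Quotient.mk x) =
      Complex.exp (Complex.I * (inner ℝ (dualVector v n) x : ℝ)) := rfl

lemma measurable_mk {d : ℕ} (v : Module.Basis (Fin d) ℝ (Space d)) :
    Measurable (Submodule.Quotient.mk : Space d → Torus v) := measurable_quotient_mk''

lemma measurable_of_mk {d : ℕ} (v : Module.Basis (Fin d) ℝ (Space d)) {β : Type*}
    [MeasurableSpace β] {f : Torus v → β} (h : Measurable fun x : Space d =>
      f (Submodule.Quotient.mk x)) : Measurable f := measurable_from_quotient.2 h

lemma measurable_planeWave {d : ℕ} (v : Module.Basis (Fin d) ℝ (Space d)) (n : Fin d → ℤ) :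
    Measurable (planeWave v n) := by
  apply measurable_of_mk
  simp only [planeWave_mk]
  fun_prop

lemma norm_planeWave {d : ℕ} (v : Module.Basis (Fin d) ℝ (Space d)) (n : Fin d → ℤ)
    (t : Torus v) : ‖planeWave v n t‖ = 1 := by
  obtain ⟨x, rfl⟩ := Submodule.Quotient.mk_surjective _ t
  rw [planeWave_mk, mul_comm, Complex.norm_exp_ofReal_mul_I]

instance {d : ℕ} (v : Module.Basis (Fin d) ℝ (Space d)) : IsFiniteMeasure (torusMeasure v) := by
  have : IsFiniteMeasure (volume.restrict (ZSpan.fundamentalDomain v)) :=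
    ⟨by simpa using (ZSpan.fundamentalDomain_isBounded v).measure_lt_top⟩
  unfold torusMeasure
  infer_instance

lemma torusMeasure_univ {d : ℕ} (v : Module.Basis (Fin d) ℝ (Space d)) :
    torusMeasure v Set.univ = volume (ZSpan.fundamentalDomain v) := by
  rw [torusMeasure, Measure.map_apply (measurable_mk v) MeasurableSet.univ]
  simp

lemma cellVolume_pos {d : ℕ} (v : Module.Basis (Fin d) ℝ (Space d)) : 0 < cellVolume v :=
  ENNReal.toReal_pos (ZSpan.measure_fundamentalDomain_ne_zero v)
    (ZSpan.fundamentalDomain_isBounded v).measure_lt_top.ne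

/-- The coordinates with respect to `v` of a point of `ℝᵈ`, modulo integers. -/
lemma coord_eq_iff {d : ℕ} (v : Module.Basis (Fin d) ℝ (Space d)) (x y : Space d) :
    ((fun i => ((v.repr x i : ℝ) : UnitAddCircle)) = fun i => ((v.repr y i : ℝ) : UnitAddCircle)) ↔
      x - y ∈ lattice v := by
  rw [v.mem_span_iff_repr_mem ℤ, funext_iff]
  refine forall_congr' fun i => ?_
  rw [← sub_eq_zero, ← AddCircle.coe_sub, AddCircle.coe_eq_zero_iff]
  simp

/-- Identification of `ℝᵈ/Λ` with `(ℝ/ℤ)ᵈ` through coordinates with respect to `v`. -/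
def coordEquiv {d : ℕ} (v : Module.Basis (Fin d) ℝ (Space d)) :
    Torus v ≃ᵐ UnitAddTorus (Fin d) where
  toFun := Quotient.lift (fun x i => ((v.repr x i : ℝ) : UnitAddCircle)) fun x y hxy =>
    (coord_eq_iff v x y).2 ((Submodule.quotientRel_def _).1 hxy)
  invFun := fun θ => Submodule.Quotient.mk
    (v.equivFun.symm (UnitAddTorus.measurableEquivPiIoc 0 θ).1)
  left_inv := by
    intro t
    obtain ⟨x, rfl⟩ := Submodule.Quotient.mk_surjective _ t
    rw [Submodule.Quotient.eq, ← coord_eq_iff]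
    funext i
    change ((v.equivFun (v.equivFun.symm _) i : ℝ) : UnitAddCircle) = _
    rw [LinearEquiv.apply_symm_apply]
    exact congrFun ((UnitAddTorus.measurableEquivPiIoc 0).symm_apply_apply
      fun i => ((v.repr x i : ℝ) : UnitAddCircle)) i
  right_inv := by
    intro θ
    funext i
    change ((v.equivFun (v.equivFun.symm _) i : ℝ) : UnitAddCircle) = _
    rw [LinearEquiv.apply_symm_apply]
    exact congrFun ((UnitAddTorus.measurableEquivPiIoc 0).symm_apply_apply θ) i
  measurable_toFun := by
    apply measurable_of_mk
    refine measurable_pi_lambda _ fun i => ?_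
    refine AddCircle.measurable_mk'.comp ?_
    exact (LinearMap.continuous_of_finiteDimensional (v.coord i)).measurable
  measurable_invFun := by
    refine (measurable_mk v).comp ?_
    have h : Continuous v.equivFun.symm :=
      LinearMap.continuous_of_finiteDimensional v.equivFun.symm.toLinearMap
    exact h.measurable.comp (measurable_subtype_coe.comp (MeasurableEquiv.measurable _))

lemma planeWave_eq {d : ℕ} (v : Module.Basis (Fin d) ℝ (Space d)) (n : Fin d → ℤ) (t : Torus v) :
    planeWave v n t = UnitAddTorus.mFourier n (coordEquiv v t) := by
  obtain ⟨x, rfl⟩ := Submodule.Quotient.mk_surjective _ t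
  rw [planeWave_mk, inner_dualVector]
  change _ = ∏ i, fourier (n i) ((v.repr x i : ℝ) : UnitAddCircle)
  simp only [fourier_coe_apply, ← Complex.exp_sum]
  congr 1
  push_cast
  rw [Finset.mul_sum, Finset.mul_sum]
  exact Finset.sum_congr rfl fun i _ => by ring

/-- The Haar probability measure on `(ℝ/ℤ)ᵈ`. -/
abbrev unitMeasure (d : ℕ) : Measure (UnitAddTorus (Fin d)) :=
  Measure.pi fun _ => AddCircle.haarAddCircle

lemma map_coordEquiv {d : ℕ} (v : Module.Basis (Fin d) ℝ (Space d)) :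
    (torusMeasure v).map (coordEquiv v) =
      volume (ZSpan.fundamentalDomain v) • unitMeasure d := by
  let L : Space d ≃L[ℝ] (Fin d → ℝ) := v.equivFun.toContinuousLinearEquiv
  let q : (Fin d → ℝ) → UnitAddTorus (Fin d) := fun y i => (y i : UnitAddCircle)
  have hq : MeasurePreserving q (volume.restrict (Set.univ.pi fun _ => Set.Ico 0 1))
      (unitMeasure d) := by
    rw [volume_pi, Measure.restrict_pi_pi]
    refine measurePreserving_pi _ _ fun i => ?_
    have := AddCircle.measurePreserving_mk 1 0
    rw [Measure.restrict_congr_set Ico_ae_eq_Ioc]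
    have h2 : (AddCircle.haarAddCircle : Measure UnitAddCircle) = volume := by
      simp [volume, AddCircle.haarAddCircle]
    rw [h2]
    simpa using! AddCircle.measurePreserving_mk 1 0
  obtain ⟨c, hc⟩ : ∃ c : ℝ≥0∞, (volume : Measure (Space d)).map L = c • volume := by
    have : ((volume : Measure (Space d)).map L).IsAddHaarMeasure := inferInstance
    have h := Measure.addHaarMeasure_unique ((volume : Measure (Space d)).map L)
      (TopologicalSpace.PositiveCompacts.piIcc01 _)
    rw [addHaarMeasure_eq_volume_pi] at h
    exact ⟨_, h⟩
  have hF : ZSpan.fundamentalDomain v = L ⁻¹' (Set.univ.pi fun _ => Set.Ico 0 1) := by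
    ext x
    simp [ZSpan.mem_fundamentalDomain, L]
  have hm : MeasurableSet (Set.univ.pi fun _ : Fin d => Set.Ico (0 : ℝ) 1) :=
    MeasurableSet.univ_pi fun _ => measurableSet_Ico
  have key : (torusMeasure v).map (coordEquiv v) = c • unitMeasure d := by
    rw [torusMeasure, Measure.map_map (coordEquiv v).measurable (measurable_mk v)]
    have h1 : (coordEquiv v) ∘ (Submodule.Quotient.mk : Space d → Torus v) = q ∘ L := rfl
    rw [h1, ← Measure.map_map hq.measurable L.continuous.measurable, hF,
      ← Measure.restrict_map L.continuous.measurable hm, hc, Measure.restrict_smul,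
      Measure.map_smul, hq.map_eq]
  have hc' : c = volume (ZSpan.fundamentalDomain v) := by
    have := congrArg (fun m => m Set.univ) key
    simpa [Measure.map_apply (coordEquiv v).measurable MeasurableSet.univ, torusMeasure_univ]
      using this.symm
  rw [key, hc']

/-- The Hilbert space `L²(𝕋ᵈ)`. -/
abbrev L2Torus {d : ℕ} (v : Module.Basis (Fin d) ℝ (Space d)) : Type :=
  Lp ℂ 2 (torusMeasure v)

lemma memLp_planeWave {d : ℕ} (v : Module.Basis (Fin d) ℝ (Space d)) (n : Fin d → ℤ) :
    MemLp (fun t => ((√(cellVolume v))⁻¹ : ℂ) * planeWave v n t) 2 (torusMeasure v) := by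
  refine MemLp.of_bound ((measurable_planeWave v n).const_mul _).aestronglyMeasurable
    (√(cellVolume v))⁻¹ (.of_forall fun t => ?_)
  rw [norm_mul, norm_planeWave, mul_one, norm_inv, Complex.norm_real, Real.norm_eq_abs,
    abs_of_nonneg (Real.sqrt_nonneg _)]

/-- The normalised plane wave `|𝕋ᵈ|^{-1/2} exp(i G·x)` as an element of `L²(𝕋ᵈ)`. -/
def planeWaveLp {d : ℕ} (v : Module.Basis (Fin d) ℝ (Space d)) (n : Fin d → ℤ) : L2Torus v :=
  (memLp_planeWave v n).toLp _

lemma integral_torus {d : ℕ} (v : Module.Basis (Fin d) ℝ (Space d))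
    (f : UnitAddTorus (Fin d) → ℂ) :
    ∫ t, f (coordEquiv v t) ∂(torusMeasure v) = cellVolume v * ∫ θ, f θ ∂(unitMeasure d) := by
  rw [← integral_map_equiv, map_coordEquiv, integral_smul_measure]
  simp [cellVolume, Measure.real]

lemma sqrt_cellVolume {d : ℕ} (v : Module.Basis (Fin d) ℝ (Space d)) :
    ((√(cellVolume v))⁻¹ : ℂ) * ((√(cellVolume v))⁻¹ : ℂ) * (cellVolume v : ℂ) = 1 := by
  have h := cellVolume_pos v
  rw [← mul_inv, ← Complex.ofReal_mul, Real.mul_self_sqrt h.le]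
  exact inv_mul_cancel₀ (by exact_mod_cast h.ne')

lemma orthonormal_planeWaveLp {d : ℕ} (v : Module.Basis (Fin d) ℝ (Space d)) :
    Orthonormal ℂ (planeWaveLp v) := by
  rw [orthonormal_iff_ite]
  intro m n
  have h0 := (orthonormal_iff_ite.1 (UnitAddTorus.orthonormal_mFourier (d := Fin d))) m n
  simp only [ContinuousMap.inner_toLp] at h0
  have h0' : ∫ θ, UnitAddTorus.mFourier n θ * starRingEnd ℂ (UnitAddTorus.mFourier m θ)
      ∂(unitMeasure d) = if m = n then 1 else 0 := by
    rw [← h0]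
    rfl
  rw [← h0', L2.inner_def]
  have h1 : ∀ᵐ t ∂(torusMeasure v), inner ℂ (planeWaveLp v m t) (planeWaveLp v n t) =
      ((√(cellVolume v))⁻¹ : ℂ) * ((√(cellVolume v))⁻¹ : ℂ) *
      (UnitAddTorus.mFourier n (coordEquiv v t) *
        starRingEnd ℂ (UnitAddTorus.mFourier m (coordEquiv v t))) := by
    filter_upwards [(memLp_planeWave v m).coeFn_toLp, (memLp_planeWave v n).coeFn_toLp]
      with t h1 h2
    rw [planeWaveLp, planeWaveLp, h1, h2, RCLike.inner_apply, planeWave_eq, planeWave_eq]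
    simp only [map_mul, map_inv₀, Complex.conj_ofReal]
    ring
  rw [integral_congr_ae h1, integral_const_mul, integral_torus v fun θ =>
    UnitAddTorus.mFourier n θ * starRingEnd ℂ (UnitAddTorus.mFourier m θ), ← mul_assoc,
    sqrt_cellVolume, one_mul]

lemma planeWaveLp_complete {d : ℕ} (v : Module.Basis (Fin d) ℝ (Space d)) :
    (Submodule.span ℂ (Set.range (planeWaveLp v)))ᗮ = ⊥ := by
  rw [Submodule.eq_bot_iff]
  intro f hf
  have hf' : ∀ n, inner ℂ (planeWaveLp v n) f = 0 := fun n =>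
    hf _ (Submodule.subset_span ⟨n, rfl⟩)
  let s := (coordEquiv v).symm
  have hV : volume (ZSpan.fundamentalDomain v) ≠ 0 := ZSpan.measure_fundamentalDomain_ne_zero v
  have hV' : volume (ZSpan.fundamentalDomain v) ≠ ∞ :=
    (ZSpan.fundamentalDomain_isBounded v).measure_lt_top.ne
  have hs : (unitMeasure d).map s = (volume (ZSpan.fundamentalDomain v))⁻¹ • torusMeasure v := by
    have h : unitMeasure d = (volume (ZSpan.fundamentalDomain v))⁻¹ •
        (torusMeasure v).map (coordEquiv v) := by
      rw [map_coordEquiv, smul_smul, ENNReal.inv_mul_cancel hV hV', one_smul]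
    rw [h, Measure.map_smul, Measure.map_map s.measurable (coordEquiv v).measurable]
    have : s ∘ coordEquiv v = id := (coordEquiv v).symm_comp_self
    rw [this, Measure.map_id]
  have hF : MemLp (fun θ => f (s θ)) 2 (unitMeasure d) := by
    have h : MemLp f 2 ((unitMeasure d).map s) := by
      rw [hs]
      exact (Lp.memLp f).smul_measure (ENNReal.inv_ne_top.2 hV)
    exact (memLp_map_measure_iff h.1 s.measurable.aemeasurable).1 h
  have hc : ∀ n, ∫ θ, starRingEnd ℂ (UnitAddTorus.mFourier n θ) * f (s θ) ∂(unitMeasure d) = 0 := by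
    intro n
    have h := integral_torus v fun θ => starRingEnd ℂ (UnitAddTorus.mFourier n θ) * f (s θ)
    have h1 : ∫ t, starRingEnd ℂ (UnitAddTorus.mFourier n (coordEquiv v t)) *
        f (s (coordEquiv v t)) ∂(torusMeasure v) = √(cellVolume v) * inner ℂ (planeWaveLp v n) f := by
      rw [L2.inner_def, ← integral_const_mul]
      refine integral_congr_ae ?_
      filter_upwards [(memLp_planeWave v n).coeFn_toLp] with t h1
      have h2 : (√(cellVolume v) : ℂ) ≠ 0 := by
        exact_mod_cast (Real.sqrt_pos.2 (cellVolume_pos v)).ne'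
      rw [planeWaveLp, h1, RCLike.inner_apply, planeWave_eq, (coordEquiv v).symm_apply_apply]
      simp only [map_mul, map_inv₀, Complex.conj_ofReal]
      field_simp
    rw [h1, hf', mul_zero] at h
    have h3 : (cellVolume v : ℂ) ≠ 0 := by exact_mod_cast (cellVolume_pos v).ne'
    exact (mul_eq_zero.1 h.symm).resolve_left h3
  have hz : hF.toLp _ = 0 := by
    apply (UnitAddTorus.mFourierBasis (d := Fin d)).repr.injective
    ext n
    refine (UnitAddTorus.mFourierBasis_repr _ n).trans ?_
    rw [map_zero]
    refine Eq.trans ?_ (hc n)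
    refine integral_congr_ae ?_
    filter_upwards [hF.coeFn_toLp] with θ hθ
    rw [hθ, UnitAddTorus.mFourier_neg, smul_eq_mul]
  have hz' : ∀ᵐ θ ∂(unitMeasure d), f (s θ) = 0 := by
    filter_upwards [hF.coeFn_toLp, Lp.coeFn_zero ℂ 2 (unitMeasure d)] with θ h1 h2
    rw [← h1, hz, h2, Pi.zero_apply]
  rw [Lp.eq_zero_iff_ae_eq_zero]
  have h4 : ∀ᵐ t ∂((unitMeasure d).map s), f t = 0 :=
    (s.measurableEmbedding.ae_map_iff).2 hz'
  rw [hs] at h4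
  exact (Measure.ae_ennreal_smul_measure_iff (ENNReal.inv_ne_zero.2 hV')).1 h4

/-- The Hilbert basis of `L²(𝕋ᵈ)` consisting of the normalised plane waves, indexed by the dual
lattice through `n ↦ ∑ nᵢkᵢ`. -/
def planeWaveBasis {d : ℕ} (v : Module.Basis (Fin d) ℝ (Space d)) :
    HilbertBasis (Fin d → ℤ) ℂ (L2Torus v) :=
  HilbertBasis.mkOfOrthogonalEqBot (orthonormal_planeWaveLp v) (planeWaveLp_complete v)

lemma planeWaveBasis_apply {d : ℕ} (v : Module.Basis (Fin d) ℝ (Space d)) (n : Fin d → ℤ) :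
    planeWaveBasis v n = planeWaveLp v n := by
  rw [planeWaveBasis, HilbertBasis.coe_mkOfOrthogonalEqBot]

/-! ### The Bloch Hamiltonian -/

/-- The Hilbert space `L²(𝕋ᵈ; ℂ²)` of pairs of functions in `L²(𝕋ᵈ)`. -/
abbrev L2TorusPair {d : ℕ} (v : Module.Basis (Fin d) ℝ (Space d)) : Type :=
  WithLp 2 (L2Torus v × L2Torus v)

/-- The operator `(-(∇ + ik)²)^{1/2}` on `L²(𝕋ᵈ)`, i.e. the Fourier multiplier
`exp(i G·x) ↦ |G + k| exp(i G·x)`, with domain `H¹(𝕋ᵈ)`. -/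
def blochSqrtLaplacian {d : ℕ} (v : Module.Basis (Fin d) ℝ (Space d)) (k : Space d) :
    L2Torus v →ₗ.[ℂ] L2Torus v :=
  diagonalOperator (planeWaveBasis v) fun n => ‖dualVector v n + k‖

lemma memLp_sqrt {α : Type*} [MeasurableSpace α] {μ : Measure α} {ρ : α → ℝ}
    (hρ : MemLp ρ ∞ μ) : MemLp (fun t => (√(ρ t) : ℂ)) ∞ μ := by
  refine memLp_top_of_bound
    ((Complex.continuous_ofReal.comp Real.continuous_sqrt).comp_aestronglyMeasurable hρ.1)
    (√(eLpNorm ρ ∞ μ).toReal) ?_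
  have h : ∀ᵐ t ∂μ, ‖ρ t‖ₑ ≤ eLpNorm ρ ∞ μ := by
    rw [eLpNorm_exponent_top]
    exact ae_le_eLpNormEssSup
  filter_upwards [h] with t ht
  rw [Complex.norm_real, Real.norm_eq_abs, abs_of_nonneg (Real.sqrt_nonneg _)]
  refine Real.sqrt_le_sqrt ((le_abs_self _).trans ?_)
  have := ENNReal.toReal_mono hρ.2.ne ht
  simpa using this

/-- Multiplication by `√ρ` as a bounded operator on `L²(𝕋ᵈ)`. -/
def mulSqrt {d : ℕ} {v : Module.Basis (Fin d) ℝ (Space d)} {ρ : Torus v → ℝ}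
    (hρ : MemLp ρ ∞ (torusMeasure v)) : L2Torus v →L[ℂ] L2Torus v :=
  (ContinuousLinearMap.mul ℂ ℂ).holderL (torusMeasure v) ∞ 2 2 ((memLp_sqrt hρ).toLp _)

lemma coeFn_mulSqrt {d : ℕ} {v : Module.Basis (Fin d) ℝ (Space d)} {ρ : Torus v → ℝ}
    (hρ : MemLp ρ ∞ (torusMeasure v)) (φ : L2Torus v) :
    mulSqrt hρ φ =ᵐ[torusMeasure v] fun t => (√(ρ t) : ℂ) * φ t := by
  have h := (ContinuousLinearMap.mul ℂ ℂ).coeFn_holder (r := 2) ((memLp_sqrt hρ).toLp _) φ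
  filter_upwards [h, (memLp_sqrt hρ).coeFn_toLp] with t h1 h2
  rw [← h2]
  exact h1

/-- The Bloch Hamiltonian
`H(k) (φ, ψ) = ((-(∇ + ik)²)^{1/2} φ + g √ρ ψ, g √ρ φ + Ω ψ)`
on `L²(𝕋ᵈ; ℂ²)`, with domain `H¹(𝕋ᵈ) × L²(𝕋ᵈ)`. -/
def blochHamiltonian {d : ℕ} (v : Module.Basis (Fin d) ℝ (Space d)) {ρ : Torus v → ℝ}
    (hρ : MemLp ρ ∞ (torusMeasure v)) (g Ω : ℝ) (k : Space d) :
    L2TorusPair v →ₗ.[ℂ] L2TorusPair v where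
  domain := (blochSqrtLaplacian v k).domain.comap (WithLp.fstₗ 2 ℂ _ _)
  toFun :=
    { toFun := fun Φ => WithLp.toLp 2
        (blochSqrtLaplacian v k ⟨Φ.1.fst, Φ.2⟩ + (g : ℂ) • mulSqrt hρ Φ.1.snd,
          (g : ℂ) • mulSqrt hρ Φ.1.fst + (Ω : ℂ) • Φ.1.snd)
      map_add' := by
        intro Φ Ψ
        have h : blochSqrtLaplacian v k ⟨(Φ + Ψ).1.fst, (Φ + Ψ).2⟩ =
            blochSqrtLaplacian v k ⟨Φ.1.fst, Φ.2⟩ + blochSqrtLaplacian v k ⟨Ψ.1.fst, Ψ.2⟩ :=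
          (blochSqrtLaplacian v k).map_add ⟨Φ.1.fst, Φ.2⟩ ⟨Ψ.1.fst, Ψ.2⟩
        rw [h, ← WithLp.toLp_add, Prod.mk_add_mk]
        congr 2
        · rw [Submodule.coe_add, WithLp.add_snd, map_add, smul_add]
          abel
        · rw [Submodule.coe_add, WithLp.add_snd, WithLp.add_fst, map_add, smul_add, smul_add]
          abel
      map_smul' := by
        intro c Φ
        have h : blochSqrtLaplacian v k ⟨(c • Φ).1.fst, (c • Φ).2⟩ =
            c • blochSqrtLaplacian v k ⟨Φ.1.fst, Φ.2⟩ :=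
          (blochSqrtLaplacian v k).map_smul c ⟨Φ.1.fst, Φ.2⟩
        rw [h, RingHom.id_apply, ← WithLp.toLp_smul, Prod.smul_mk]
        congr 2
        · rw [Submodule.coe_smul, WithLp.smul_snd, map_smul, smul_add, smul_comm (g : ℂ) c]
        · rw [Submodule.coe_smul, WithLp.smul_snd, WithLp.smul_fst, map_smul, smul_add,
            smul_comm (g : ℂ) c, smul_comm (Ω : ℂ) c] }

end Bloch

end

/-!
The Hamiltonian is a block operator `H (φ, ψ) = (A φ + B ψ, B φ + Ω ψ)` in which `A ≥ 0` is diagonal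
in the basis of plane waves, with entries `|G + k|` tending to infinity, and `B = g √ρ` is bounded,
symmetric and of infinite rank (`not_finiteDimensional_quotient_ker_mulSqrt`). The spectral theorem
is proved for all such operators (`spectrum_coupledOperator`).

*Diagonalisation.* For `μ` very negative, `R = (H - μ)⁻¹` exists. As `A` has compact resolvent, `R`
differs by a compact operator from `c = (Ω - μ)⁻¹` times the projection to the second component, so
that `R (R - c)` is compact (`isCompactOperator_resolvent_coupledOperator`). The spectral theorem
for this compact symmetric operator yields an orthonormal basis `bₙ` of eigenvectors of `R`, hence of
`H`, whose eigenvalues `aₙ` are bounded below and accumulate at most at `Ω` and at infinity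
(`exists_eigenbasis_coupledOperator`). Apart from `Ω`, the spectrum consists of the `aₙ`, all of
them discrete eigenvalues (`isDiscreteEigenvalue_of_eigenbasis`).

*Eigenvalues around `Ω`.* The form of `H - Ω` vanishes on `0 × E`. If only finitely many `aₙ` were
below `Ω`, then this form would be positive semidefinite on a subspace of `0 × E` of finite
codimension, which would therefore consist of eigenvectors for `Ω`, and there `B` would vanish
(`infinite_lt`). There are infinitely many `aₙ` above `Ω` since `A` is unbounded (`infinite_gt`),
and they are nonnegative since `A` is (`nonneg_of_lt`). They do not accumulate at `Ω`, so that they can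
be enumerated in increasing order: if there were infinitely many in `(Ω, C]`, the vanishing of the
form on `0 × E` would be violated, because the spectral subspace of `(-∞, C]` contains only a
finite-dimensional space of vectors `(φ, 0)` (`finite_gt_le`).
-/

noncomputable section

namespace Bloch

universe u

/-! ### Diagonal and compact operators in a Hilbert basis -/

section HilbertBasis

variable {ι E : Type*} [NormedAddCommGroup E] [InnerProductSpace ℂ E]

lemma eq_of_forall_inner_eq (e : HilbertBasis ι ℂ E) {x y : E}
    (h : ∀ n, inner ℂ (e n) x = inner ℂ (e n) y) : x = y := by
  apply e.repr.injective
  ext n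
  rw [e.repr_apply_apply, e.repr_apply_apply, h]

lemma hasSum_normSq_inner (e : HilbertBasis ι ℂ E) (x : E) :
    HasSum (fun n => ‖inner ℂ (e n) x‖ ^ 2) (‖x‖ ^ 2) := by
  have h := (e.hasSum_inner_mul_inner x x).mapL Complex.reCLM
  have h2 : Complex.reCLM (inner ℂ x x) = ‖x‖ ^ 2 := by
    have := inner_self_eq_norm_sq (𝕜 := ℂ) x
    simpa using this
  rw [h2] at h
  refine h.congr_fun ?_
  intro n
  have : inner ℂ x (e n) * inner ℂ (e n) x = ((‖inner ℂ (e n) x‖ ^ 2 : ℝ) : ℂ) := by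
    rw [← inner_conj_symm, mul_comm, Complex.mul_conj, Complex.normSq_eq_norm_sq]
  simp only [Complex.reCLM_apply, this, Complex.ofReal_re]

lemma norm_le_of_forall_norm_inner_le (e : HilbertBasis ι ℂ E) {x y : E} {M : ℝ} (hM : 0 ≤ M)
    (h : ∀ n, ‖inner ℂ (e n) x‖ ≤ M * ‖inner ℂ (e n) y‖) : ‖x‖ ≤ M * ‖y‖ := by
  have h1 := hasSum_normSq_inner e x
  have h2 := (hasSum_normSq_inner e y).mul_left (M ^ 2)
  have h3 : ‖x‖ ^ 2 ≤ M ^ 2 * ‖y‖ ^ 2 := by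
    refine hasSum_le (fun n => ?_) h1 h2
    rw [← mul_pow]
    exact pow_le_pow_left₀ (norm_nonneg _) (h n) 2
  rw [← mul_pow] at h3
  exact (pow_le_pow_iff_left₀ (norm_nonneg _) (by positivity) two_ne_zero).1 h3

/-- A bounded sequence of multipliers defines a bounded diagonal operator. -/
lemma exists_diagonal (e : HilbertBasis ι ℂ E) (c : ι → ℂ) {M : ℝ} (hM : 0 ≤ M)
    (hc : ∀ n, ‖c n‖ ≤ M) :
    ∃ D : E →L[ℂ] E, ‖D‖ ≤ M ∧ ∀ x n, inner ℂ (e n) (D x) = c n * inner ℂ (e n) x := by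
  have hmem : ∀ x : E, Memℓp (fun n => c n * inner ℂ (e n) x) 2 := by
    intro x
    rw [memℓp_gen_iff (by simp)]
    refine Summable.of_nonneg_of_le (fun n => by positivity) (fun n => ?_)
      ((hasSum_normSq_inner e x).summable.mul_left (M ^ 2))
    simp only [ENNReal.toReal_ofNat, Real.rpow_ofNat]
    rw [norm_mul, mul_pow]
    gcongr
    exact hc n
  have hrepr : ∀ (x : E) (n : ι), inner ℂ (e n) (e.repr.symm
      (⟨fun n => c n * inner ℂ (e n) x, hmem x⟩ : lp (fun _ : ι => ℂ) 2)) =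
      c n * inner ℂ (e n) x := by
    intro x n
    rw [← e.repr_apply_apply, LinearIsometryEquiv.apply_symm_apply]
  let L : E →ₗ[ℂ] E :=
    { toFun := fun x => e.repr.symm
        (⟨fun n => c n * inner ℂ (e n) x, hmem x⟩ : lp (fun _ : ι => ℂ) 2)
      map_add' := by
        intro x y
        refine eq_of_forall_inner_eq e fun n => ?_
        rw [inner_add_right, hrepr, hrepr, hrepr, inner_add_right, mul_add]
      map_smul' := by
        intro z x
        refine eq_of_forall_inner_eq e fun n => ?_
        rw [RingHom.id_apply, inner_smul_right, hrepr, hrepr, inner_smul_right, mul_left_comm] }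
  refine ⟨L.mkContinuous M fun x => ?_, L.mkContinuous_norm_le hM _, fun x n => hrepr x n⟩
  refine norm_le_of_forall_norm_inner_le e hM fun n => ?_
  rw [show inner ℂ (e n) (L x) = c n * inner ℂ (e n) x from hrepr x n, norm_mul]
  exact mul_le_mul_of_nonneg_right (hc n) (norm_nonneg _)

/-- A diagonal operator whose multipliers tend to zero is compact, being the norm limit of its
truncations to finitely many basis vectors. -/
lemma isCompactOperator_of_diagonal [CompleteSpace E] (e : HilbertBasis ι ℂ E) {c : ι → ℂ}
    (hc : ∀ ε > 0, {n | ε ≤ ‖c n‖}.Finite) {D : E →L[ℂ] E}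
    (hD : ∀ x n, inner ℂ (e n) (D x) = c n * inner ℂ (e n) x) : IsCompactOperator D := by
  classical
  have hsingle : ∀ n, IsCompactOperator
      ((innerSL ℂ (e n)).smulRight (e n) : E →L[ℂ] E) := by
    intro n
    exact (isCompactOperator_of_locallyCompactSpace_dom (innerSL ℂ (e n))).clm_comp
      ((ContinuousLinearMap.id ℂ ℂ).smulRight (e n))
  let F : Finset ι → (E →L[ℂ] E) := fun s =>
    ∑ n ∈ s, c n • ((innerSL ℂ (e n)).smulRight (e n) : E →L[ℂ] E)
  have hF : ∀ s, IsCompactOperator (F s) := fun s =>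
    (compactOperator (RingHom.id ℂ) E E).sum_mem fun n _ => (hsingle n).smul (c n)
  have hFapp : ∀ s x n, inner ℂ (e n) (F s x) = if n ∈ s then c n * inner ℂ (e n) x else 0 := by
    intro s x n
    simp only [F, _root_.sum_apply, _root_.smul_apply,
      ContinuousLinearMap.smulRight_apply, innerSL_apply_apply, inner_sum, inner_smul_right,
      orthonormal_iff_ite.1 e.orthonormal]
    simp
  refine isCompactOperator_of_tendsto (l := Filter.atTop) (F := F) ?_ (.of_forall hF)
  rw [Metric.tendsto_atTop]
  intro ε hε
  refine ⟨(hc (ε / 2) (half_pos hε)).toFinset, fun s hs => ?_⟩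
  rw [dist_eq_norm]
  refine lt_of_le_of_lt (ContinuousLinearMap.opNorm_le_bound _ (half_pos hε).le fun x => ?_)
    (half_lt_self hε)
  refine norm_le_of_forall_norm_inner_le e (half_pos hε).le fun n => ?_
  rw [_root_.sub_apply, inner_sub_right, hFapp, hD]
  split_ifs with h
  · rw [sub_self, norm_zero]
    positivity
  · rw [zero_sub, norm_neg, norm_mul]
    refine mul_le_mul_of_nonneg_right ?_ (norm_nonneg _)
    by_contra hn
    exact h (hs ((hc (ε / 2) (half_pos hε)).mem_toFinset.2 (not_le.1 hn).le))

/-- The eigenvalues of a compact operator along an orthonormal family of eigenvectors accumulate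
only at zero. -/
lemma finite_le_norm_eigenvalue {b : ι → E} (hb : Orthonormal ℂ b)
    {T : E →L[ℂ] E} (hT : IsCompactOperator T) {t : ι → ℂ} (hbt : ∀ n, T (b n) = t n • b n)
    {ε : ℝ} (hε : 0 < ε) : {n | ε ≤ ‖t n‖}.Finite := by
  by_contra hinf
  let f := Set.Infinite.natEmbedding _ hinf
  obtain ⟨K, hK, hTK⟩ := hT.image_closedBall_subset_compact (𝕜₁ := ℂ) (f := (T : E →ₗ[ℂ] E)) 1
  have hmem : ∀ j, T (b (f j)) ∈ K := fun j => hTK ⟨b (f j), by simp [hb.1], rfl⟩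
  obtain ⟨y, -, φ, hφ, hlim⟩ := hK.tendsto_subseq hmem
  obtain ⟨N, hN⟩ := Metric.cauchySeq_iff.1 hlim.cauchySeq ε hε
  have h1 := hN N le_rfl (N + 1) N.le_succ
  have hne : (f (φ N) : ι) ≠ f (φ (N + 1)) := fun h =>
    (hφ N.lt_succ_self).ne (f.injective (Subtype.ext h))
  simp only [Function.comp_apply, hbt, dist_eq_norm] at h1
  have h2 := norm_sub_sq (𝕜 := ℂ) (t (f (φ N)) • b (f (φ N)))
    (t (f (φ (N + 1))) • b (f (φ (N + 1))))
  rw [inner_smul_left, inner_smul_right, hb.2 hne] at h2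
  simp only [norm_smul, hb.1, mul_zero, map_zero, sub_zero, mul_one] at h2
  have h3 : ε ≤ ‖t (f (φ N))‖ := (f (φ N)).2
  nlinarith [norm_nonneg (t (f (φ (N + 1)))), norm_nonneg
    (t (f (φ N)) • b (f (φ N)) - t (f (φ (N + 1))) • b (f (φ (N + 1))))]

end HilbertBasis

section Eigenbasis

variable {E : Type*} [NormedAddCommGroup E] [InnerProductSpace ℂ E] [CompleteSpace E]

/-- If `R` is symmetric and injective and `R (R - c)` is compact, the eigenspaces of `R` are total:
an eigenspace of the compact operator `R (R - c)` either is finite-dimensional and invariant under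
`R`, so that `R` can be diagonalised in it, or consists of eigenvectors of `R` for `c`. -/
lemma orthogonal_iSup_eigenspace_eq_bot {R : E →L[ℂ] E} (hR : (R : E →ₗ[ℂ] E).IsSymmetric)
    (hinj : Function.Injective R) (c : ℝ) (hc : IsCompactOperator (R ∘L R - (c : ℂ) • R)) :
    (⨆ μ : ℂ, Module.End.eigenspace (R : E →ₗ[ℂ] E) μ)ᗮ = ⊥ := by
  set T : E →L[ℂ] E := R ∘L R - (c : ℂ) • R with hTdef
  have hTapp : ∀ x, T x = R (R x) - (c : ℂ) • R x := fun x => rfl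
  have hT : (T : E →ₗ[ℂ] E).IsSymmetric := by
    intro x y
    have h : ∀ x y, inner ℂ (R x) y = inner ℂ x (R y) := hR
    simp only [ContinuousLinearMap.coe_coe, hTapp, inner_sub_left, inner_sub_right,
      inner_smul_left, inner_smul_right, h, Complex.conj_ofReal]
  rw [Submodule.eq_bot_iff]
  intro x hx
  rw [← Submodule.iInf_orthogonal, Submodule.mem_iInf] at hx
  suffices h : x ∈ (⨆ τ : ℂ, Module.End.eigenspace (T : E →ₗ[ℂ] E) τ)ᗮ by
    rwa [ContinuousLinearMap.orthogonalComplement_iSup_eigenspaces_eq_bot hc hT,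
      Submodule.mem_bot] at h
  rw [← Submodule.iInf_orthogonal, Submodule.mem_iInf]
  intro τ
  by_cases hτ : τ = 0
  · intro y hy
    rw [hτ, Module.End.mem_eigenspace_iff, zero_smul] at hy
    have hy' : R (R y) - (c : ℂ) • R y = 0 := hy
    rw [← map_smul, ← map_sub, map_eq_zero_iff R hinj, sub_eq_zero] at hy'
    exact hx c y (Module.End.mem_eigenspace_iff.2 hy')
  · have hfin := ContinuousLinearMap.finite_dimensional_eigenspace hc τ hτ
    set V := Module.End.eigenspace (T : E →ₗ[ℂ] E) τ with hV
    have hinv : ∀ y ∈ V, (R : E →ₗ[ℂ] E) y ∈ V := by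
      intro y hy
      rw [hV, Module.End.mem_eigenspace_iff] at hy ⊢
      have hy' : T y = τ • y := hy
      change T (R y) = τ • R y
      rw [← map_smul, ← hy', hTapp, hTapp, map_sub, map_smul]
    have h1 := (hR.restrict_invariant hinv).orthogonalComplement_iSup_eigenspaces_eq_bot
    rw [Submodule.orthogonal_eq_bot_iff] at h1
    have h2 : ∀ w ∈ (⨆ μ : ℂ, Module.End.eigenspace ((R : E →ₗ[ℂ] E).restrict hinv) μ),
        inner ℂ (w : E) x = 0 := by
      intro w hw
      induction hw using Submodule.iSup_induction' with
      | mem μ w hw =>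
        refine hx μ w (Module.End.mem_eigenspace_iff.2 ?_)
        exact congrArg Subtype.val (Module.End.mem_eigenspace_iff.1 hw)
      | zero => simp
      | add u w _ _ hu hw => rw [Submodule.coe_add, inner_add_left, hu, hw, add_zero]
    intro y hy
    exact h2 ⟨y, hy⟩ (h1 ▸ Submodule.mem_top)

/-- Diagonalisation of a symmetric injective operator `R` for which `R (R - c)` is compact. -/
lemma exists_hilbertBasis_of_isCompactOperator {E : Type u} [NormedAddCommGroup E]
    [InnerProductSpace ℂ E] [CompleteSpace E] {R : E →L[ℂ] E}
    (hR : (R : E →ₗ[ℂ] E).IsSymmetric)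
    (hinj : Function.Injective R) (c : ℝ) (hc : IsCompactOperator (R ∘L R - (c : ℂ) • R)) :
    ∃ (ι : Type u) (b : HilbertBasis ι ℂ E) (r : ι → ℝ), ∀ n, R (b n) = (r n : ℂ) • b n := by
  have hbot := orthogonal_iSup_eigenspace_eq_bot hR hinj c hc
  have hcl : ∀ μ : ℂ, CompleteSpace (Module.End.eigenspace (R : E →ₗ[ℂ] E) μ) := by
    intro μ
    have : (Module.End.eigenspace (R : E →ₗ[ℂ] E) μ : Set E) = {x | R x = μ • x} := by
      ext x
      exact Module.End.mem_eigenspace_iff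
    refine IsClosed.completeSpace_coe (s := (Module.End.eigenspace (R : E →ₗ[ℂ] E) μ : Set E))
      (hs := ?_)
    rw [this]
    exact isClosed_eq R.continuous (continuous_const_smul μ)
  choose w e he using fun μ : ℂ => exists_hilbertBasis ℂ (Module.End.eigenspace (R : E →ₗ[ℂ] E) μ)
  have hon : Orthonormal ℂ fun p : Σ μ : ℂ, w μ => (e p.1 p.2 : E) :=
    hR.orthogonalFamily_eigenspaces.orthonormal_sigma_orthonormal fun μ => (e μ).orthonormal
  have hsp : (Submodule.span ℂ (Set.range fun p : Σ μ : ℂ, w μ => (e p.1 p.2 : E)))ᗮ = ⊥ := by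
    rw [Submodule.eq_bot_iff]
    intro x hx
    have hx' : ∀ p : Σ μ : ℂ, w μ, inner ℂ (e p.1 p.2 : E) x = 0 := fun p =>
      hx _ (Submodule.subset_span ⟨p, rfl⟩)
    rw [← Submodule.mem_bot ℂ, ← hbot, ← Submodule.iInf_orthogonal, Submodule.mem_iInf]
    intro μ y hy
    have hsum := ((e μ).hasSum_repr ⟨y, hy⟩).mapL
      ((innerSL ℂ x) ∘L (Module.End.eigenspace (R : E →ₗ[ℂ] E) μ).subtypeL)
    have h0 : ∀ n : w μ, inner ℂ x (e μ n : E) = 0 := fun n => by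
      rw [← inner_conj_symm, hx' ⟨μ, n⟩, map_zero]
    have hxy : inner ℂ x y = 0 := by
      refine hsum.unique ?_
      simp [h0, hasSum_zero]
    rw [← inner_conj_symm, hxy, map_zero]
  have hRe : ∀ p : Σ μ : ℂ, w μ, R (e p.1 p.2 : E) = p.1 • (e p.1 p.2 : E) := fun p =>
    Module.End.mem_eigenspace_iff.1 (e p.1 p.2).2
  refine ⟨Σ μ : ℂ, w μ, HilbertBasis.mkOfOrthogonalEqBot hon hsp, fun p => p.1.re, fun p => ?_⟩
  rw [HilbertBasis.coe_mkOfOrthogonalEqBot, hRe]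
  congr 1
  have h := hR (e p.1 p.2 : E) (e p.1 p.2 : E)
  simp only [ContinuousLinearMap.coe_coe, hRe, inner_smul_left, inner_smul_right,
    inner_self_eq_norm_sq_to_K, hon.1 p] at h
  have h' : starRingEnd ℂ p.1 = p.1 := by simpa using h
  exact (Complex.conj_eq_iff_re.1 h').symm

end Eigenbasis

/-! ### Resolvents and spectra of unbounded operators with an eigenbasis -/

section Resolvent

/-- `R` is the (bounded) resolvent `(T - z)⁻¹` of the unbounded operator `T` at `z`. -/
def IsResolvent {X : Type*} [NormedAddCommGroup X] [NormedSpace ℂ X] (T : X →ₗ.[ℂ] X) (z : ℂ)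
    (R : X →L[ℂ] X) : Prop :=
  (∀ x : X, ∃ h : R x ∈ T.domain, T ⟨R x, h⟩ - z • R x = x) ∧
    ∀ y : T.domain, R (T y - z • (y : X)) = y

lemma mem_eigenspace_iff {X : Type*} [NormedAddCommGroup X] [NormedSpace ℂ X] {T : X →ₗ.[ℂ] X}
    {z : ℂ} {x : X} : x ∈ eigenspace T z ↔ ∃ h : x ∈ T.domain, T ⟨x, h⟩ = z • x := by
  constructor
  · rintro ⟨y, hy, rfl⟩
    exact ⟨y.2, sub_eq_zero.1 hy⟩
  · rintro ⟨h, hx⟩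
    exact ⟨⟨x, h⟩, sub_eq_zero.2 hx, rfl⟩

lemma mem_spectrum_of_mem_eigenspace {X : Type*} [NormedAddCommGroup X] [NormedSpace ℂ X]
    {T : X →ₗ.[ℂ] X} {z : ℂ} {x : X} (hx : x ∈ eigenspace T z) (hx0 : x ≠ 0) :
    z ∈ spectrum T := by
  rintro ⟨R, -, hR⟩
  obtain ⟨h, hTx⟩ := mem_eigenspace_iff.1 hx
  have := hR ⟨x, h⟩
  rw [hTx, sub_self, map_zero] at this
  exact hx0 this.symm

variable {X : Type*} [NormedAddCommGroup X] [InnerProductSpace ℂ X] {T : X →ₗ.[ℂ] X}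

lemma inner_apply_of_mem_eigenspace (hT : T.IsFormalAdjoint T) {a : ℝ} {b : X}
    (hb : b ∈ eigenspace T (a : ℂ)) (y : T.domain) :
    inner ℂ b (T y) = (a : ℂ) * inner ℂ b (y : X) := by
  obtain ⟨h, hTb⟩ := mem_eigenspace_iff.1 hb
  rw [← hT ⟨b, h⟩ y, hTb, inner_smul_left, Complex.conj_ofReal]

/-- The quadratic form of an operator that acts diagonally on `x`, written in the basis. -/
lemma hasSum_re_inner_of_diagonal {ι : Type*} (b : HilbertBasis ι ℂ X) {c : ι → ℝ} {x y : X}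
    (h : ∀ n, inner ℂ (b n) y = (c n : ℂ) * inner ℂ (b n) x) :
    HasSum (fun n => c n * ‖inner ℂ (b n) x‖ ^ 2) (inner ℂ x y).re := by
  refine ((b.hasSum_inner_mul_inner x y).mapL Complex.reCLM).congr_fun fun n => ?_
  have : inner ℂ x (b n) * inner ℂ (b n) y =
      ((c n * ‖inner ℂ (b n) x‖ ^ 2 : ℝ) : ℂ) := by
    rw [h, ← inner_conj_symm, mul_left_comm, mul_comm (starRingEnd ℂ _),
      Complex.mul_conj, Complex.normSq_eq_norm_sq]
    push_cast
    ring
  simp only [Complex.reCLM_apply, this, Complex.ofReal_re]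

lemma IsResolvent.isSymmetric (hT : T.IsFormalAdjoint T) {μ : ℝ} {R : X →L[ℂ] X}
    (hR : IsResolvent T (μ : ℂ) R) : (R : X →ₗ[ℂ] X).IsSymmetric := by
  intro x y
  obtain ⟨hx, hx'⟩ := hR.1 x
  obtain ⟨hy, hy'⟩ := hR.1 y
  have h := hT ⟨R x, hx⟩ ⟨R y, hy⟩
  change inner ℂ (R x) y = inner ℂ x (R y)
  conv_lhs => rw [← hy']
  conv_rhs => rw [← hx']
  rw [inner_sub_left, inner_sub_right, h, inner_smul_left, inner_smul_right, Complex.conj_ofReal]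

lemma IsResolvent.injective {z : ℂ} {R : X →L[ℂ] X} (hR : IsResolvent T z R) :
    Function.Injective R := by
  rw [injective_iff_map_eq_zero]
  intro x hx
  obtain ⟨h, hx'⟩ := hR.1 x
  have h0 : (⟨R x, h⟩ : T.domain) = 0 := Subtype.ext hx
  rwa [h0, T.map_zero, hx, smul_zero, sub_self, eq_comm] at hx'

lemma IsResolvent.mem_eigenspace {μ r : ℝ} {R : X →L[ℂ] X} (hR : IsResolvent T (μ : ℂ) R) {b : X}
    (hb0 : b ≠ 0) (hb : R b = (r : ℂ) • b) : r ≠ 0 ∧ b ∈ eigenspace T ((μ + r⁻¹ : ℝ) : ℂ) := by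
  have hr : r ≠ 0 := by
    rintro rfl
    rw [Complex.ofReal_zero, zero_smul, map_eq_zero_iff R hR.injective] at hb
    exact hb0 hb
  have hr' : (r : ℂ) ≠ 0 := by exact_mod_cast hr
  refine ⟨hr, ?_⟩
  have hb' : R ((r : ℂ)⁻¹ • b) = b := by rw [map_smul, hb, smul_smul, inv_mul_cancel₀ hr', one_smul]
  obtain ⟨h, h'⟩ := hR.1 ((r : ℂ)⁻¹ • b)
  simp only [hb'] at h h'
  refine mem_eigenspace_iff.2 ⟨h, ?_⟩
  rw [sub_eq_iff_eq_add'.1 h']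
  push_cast
  rw [add_smul]

/-- Given one resolvent and a Hilbert basis of eigenvectors, every point at positive distance from
the eigenvalues belongs to the resolvent set. -/
lemma mem_resolventSet_of_eigenbasis {ι : Type*} (hT : T.IsFormalAdjoint T) {μ : ℝ}
    {R : X →L[ℂ] X} (hR : IsResolvent T (μ : ℂ) R) (b : HilbertBasis ι ℂ X) {a : ι → ℝ}
    (hb : ∀ n, b n ∈ eigenspace T (a n : ℂ)) {z : ℂ} {δ : ℝ} (hδ : 0 < δ)
    (hz : ∀ n, δ ≤ ‖(a n : ℂ) - z‖) : z ∈ resolventSet T := by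
  have hz0 : ∀ n, (a n : ℂ) - z ≠ 0 := fun n h => by
    have := hz n
    rw [h, norm_zero] at this
    linarith
  obtain ⟨D, -, hD⟩ := exists_diagonal b (fun n => ((a n : ℂ) - z)⁻¹) (inv_nonneg.2 hδ.le)
    fun n => by
      rw [norm_inv]
      exact inv_anti₀ hδ (hz n)
  have hμ : ∀ n, (a n : ℂ) - μ ≠ 0 := by
    intro n h
    refine mem_spectrum_of_mem_eigenspace (hb n) (b.orthonormal.ne_zero n) ?_
    rw [sub_eq_zero.1 h]
    exact ⟨R, hR⟩
  -- The resolvent identity gives `D x` as a value of `R`, hence as an element of the domain.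
  have hRD : ∀ x, R (x + (z - μ) • D x) = D x := by
    intro x
    refine eq_of_forall_inner_eq b fun n => mul_left_cancel₀ (hμ n) ?_
    obtain ⟨h, h'⟩ := hR.1 (x + (z - μ) • D x)
    have h1 := congrArg (inner ℂ (b n)) h'
    rw [inner_sub_right, inner_apply_of_mem_eigenspace hT (hb n), inner_smul_right,
      inner_add_right, inner_smul_right, hD] at h1
    rw [sub_mul, h1, hD]
    field_simp [hz0 n]
    ring
  refine ⟨D, fun x => ?_, fun y => ?_⟩
  · obtain ⟨h, h'⟩ := hR.1 (x + (z - μ) • D x)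
    simp only [hRD] at h h'
    refine ⟨h, ?_⟩
    rw [sub_eq_iff_eq_add.1 h', sub_smul]
    abel
  · refine eq_of_forall_inner_eq b fun n => ?_
    rw [hD, inner_sub_right, inner_apply_of_mem_eigenspace hT (hb n), inner_smul_right, ← sub_mul,
      inv_mul_cancel_left₀ (hz0 n)]

/-- If only finitely many eigenvalues of an eigenbasis lie near the point `z` of the spectrum, then
`z` is one of them, and it is a discrete eigenvalue. -/
lemma isDiscreteEigenvalue_of_eigenbasis {ι : Type*} (hT : T.IsFormalAdjoint T) {μ : ℝ}
    {R : X →L[ℂ] X} (hR : IsResolvent T (μ : ℂ) R) (b : HilbertBasis ι ℂ X) {a : ι → ℝ}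
    (hb : ∀ n, b n ∈ eigenspace T (a n : ℂ)) {z : ℂ} {ε : ℝ} (hε : 0 < ε)
    (hfin : {n | ‖(a n : ℂ) - z‖ < ε}.Finite) (hz : z ∈ spectrum T) :
    (∃ n, z = a n) ∧ IsDiscreteEigenvalue T z := by
  -- a radius below which the only possible eigenvalue is `z` itself
  obtain ⟨δ, hδ, hgap⟩ : ∃ δ > 0, ∀ n, (a n : ℂ) ≠ z → δ ≤ ‖(a n : ℂ) - z‖ := by
    have h1 : {n | ‖(a n : ℂ) - z‖ < ε ∧ (a n : ℂ) ≠ z}.Finite := hfin.subset fun n hn => hn.1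
    rcases {n | ‖(a n : ℂ) - z‖ < ε ∧ (a n : ℂ) ≠ z}.eq_empty_or_nonempty with he | hne
    · refine ⟨ε, hε, fun n hn => ?_⟩
      by_contra hlt
      exact Set.eq_empty_iff_forall_notMem.1 he n ⟨not_le.1 hlt, hn⟩
    · obtain ⟨m, hm, hmin⟩ := h1.exists_minimalFor (fun n => ‖(a n : ℂ) - z‖) _ hne
      refine ⟨‖(a m : ℂ) - z‖, norm_pos_iff.2 (sub_ne_zero.2 hm.2), fun n hn => ?_⟩
      rcases lt_or_ge ‖(a n : ℂ) - z‖ ε with hlt | hge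
      · exact (le_total _ _).elim id fun h => hmin ⟨hlt, hn⟩ h
      · exact hm.1.le.trans hge
  have hex : ∃ n, z = a n := by
    by_contra hno
    exact hz (mem_resolventSet_of_eigenbasis hT hR b hb hδ fun n => hgap n fun h => hno ⟨n, h.symm⟩)
  refine ⟨hex, hz, ⟨δ / 2, half_pos hδ, fun w hw hwz => ?_⟩, ?_, ?_⟩
  · by_contra hlt
    have hd := dist_pos.2 hwz
    refine hw (mem_resolventSet_of_eigenbasis hT hR b hb hd fun n => ?_)
    by_cases hn : (a n : ℂ) = z
    · rw [hn, ← dist_eq_norm, dist_comm]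
    · have h1 := hgap n hn
      have h2 := dist_triangle (a n : ℂ) w z
      rw [← dist_eq_norm] at h1 ⊢
      linarith [not_le.1 hlt]
  · obtain ⟨n, rfl⟩ := hex
    intro hbot
    refine b.orthonormal.ne_zero n ?_
    have := hb n
    rwa [hbot, Submodule.mem_bot] at this
  · have hfin' : {n | (a n : ℂ) = z}.Finite := hfin.subset fun n hn => by
      simpa [hn.out] using hε
    have := FiniteDimensional.span_of_finite ℂ (hfin'.image b)
    refine Submodule.finiteDimensional_of_le
      (S₂ := Submodule.span ℂ (b '' {n | (a n : ℂ) = z})) fun x hx => ?_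
    obtain ⟨h, hTx⟩ := mem_eigenspace_iff.1 hx
    have hzero : ∀ n ∉ hfin'.toFinset, b.repr x n • b n = 0 := by
      intro n hn
      have h1 := inner_apply_of_mem_eigenspace hT (hb n) ⟨x, h⟩
      rw [hTx, inner_smul_right] at h1
      have h2 : (a n : ℂ) ≠ z := fun h => hn (hfin'.mem_toFinset.2 h)
      have h3 : ((a n : ℂ) - z) * inner ℂ (b n) x = 0 := by
        rw [sub_mul, ← h1, sub_self]
      rw [b.repr_apply_apply, (mul_eq_zero.1 h3).resolve_left (sub_ne_zero.2 h2), zero_smul]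
    rw [(b.hasSum_repr x).unique (hasSum_sum_of_ne_finset_zero hzero)]
    exact Submodule.sum_mem _ fun n hn => Submodule.smul_mem _ _
      (Submodule.subset_span ⟨n, hfin'.mem_toFinset.1 hn, rfl⟩)

end Resolvent

section Diagonal

variable {ι E : Type*} [NormedAddCommGroup E] [InnerProductSpace ℂ E]

lemma inner_diagonalOperator (e : HilbertBasis ι ℂ E) (α : ι → ℝ)
    (y : (diagonalOperator e α).domain) (n : ι) :
    inner ℂ (e n) (diagonalOperator e α y) = (α n : ℂ) * inner ℂ (e n) (y : E) := by
  rw [← e.repr_apply_apply]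
  change e.repr (e.repr.symm _) n = _
  rw [LinearIsometryEquiv.apply_symm_apply]

lemma diagonalOperator_isFormalAdjoint (e : HilbertBasis ι ℂ E) (α : ι → ℝ) :
    (diagonalOperator e α).IsFormalAdjoint (diagonalOperator e α) := by
  intro x y
  rw [← e.tsum_inner_mul_inner, ← e.tsum_inner_mul_inner]
  refine tsum_congr fun n => ?_
  rw [inner_diagonalOperator, ← inner_conj_symm, inner_diagonalOperator, map_mul,
    Complex.conj_ofReal, inner_conj_symm]
  ring

lemma basis_mem_eigenspace (e : HilbertBasis ι ℂ E) (α : ι → ℝ) (n : ι) :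
    e n ∈ eigenspace (diagonalOperator e α) (α n : ℂ) := by
  classical
  have hite : ∀ m, inner ℂ (e m) (e n) = if m = n then (1 : ℂ) else 0 := fun m =>
    orthonormal_iff_ite.1 e.orthonormal m n
  have h : e n ∈ (diagonalOperator e α).domain := by
    change Memℓp (fun m => (α m : ℂ) * inner ℂ (e m) (e n)) 2
    refine Memℓp.of_exponent_ge (memℓp_zero ?_) zero_le
    refine (Set.finite_singleton n).subset fun m hm => ?_
    by_contra hne
    exact hm (by simp [hite, show m ≠ n from hne])
  refine mem_eigenspace_iff.2 ⟨h, eq_of_forall_inner_eq e fun m => ?_⟩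
  rw [inner_diagonalOperator, inner_smul_right, hite]
  split_ifs with hmn
  · rw [hmn]
  · simp

lemma exists_isResolvent_diagonalOperator (e : HilbertBasis ι ℂ E) {α : ι → ℝ} {μ δ : ℝ}
    (hδ : 0 < δ) (hμ : ∀ n, δ ≤ α n - μ) :
    ∃ S : E →L[ℂ] E, IsResolvent (diagonalOperator e α) (μ : ℂ) S ∧ ‖S‖ ≤ δ⁻¹ ∧
      ∀ x n, inner ℂ (e n) (S x) = ((α n - μ : ℝ) : ℂ)⁻¹ * inner ℂ (e n) x := by
  have hne : ∀ n, (α n : ℂ) - μ ≠ 0 := fun n => by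
    have : 0 < α n - μ := hδ.trans_le (hμ n)
    exact_mod_cast this.ne'
  obtain ⟨S, hS, hS'⟩ := exists_diagonal e (fun n => ((α n - μ : ℝ) : ℂ)⁻¹) (inv_nonneg.2 hδ.le)
    fun n => by
      rw [norm_inv, Complex.norm_real]
      exact inv_anti₀ hδ ((hμ n).trans (le_abs_self _))
  have key : ∀ x n, (α n : ℂ) * inner ℂ (e n) (S x) = inner ℂ (e n) (x + (μ : ℂ) • S x) := by
    intro x n
    rw [inner_add_right, inner_smul_right, hS']
    push_cast
    field_simp [hne n]
    ring
  have hdom : ∀ x, S x ∈ (diagonalOperator e α).domain := by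
    intro x
    change Memℓp (fun n => (α n : ℂ) * inner ℂ (e n) (S x)) 2
    have h : (fun n => (α n : ℂ) * inner ℂ (e n) (S x)) = e.repr (x + (μ : ℂ) • S x) := by
      funext n
      rw [key, e.repr_apply_apply]
    rw [h]
    exact lp.memℓp (e.repr (x + (μ : ℂ) • S x))
  refine ⟨S, ⟨fun x => ⟨hdom x, eq_of_forall_inner_eq e fun n => ?_⟩, fun y =>
    eq_of_forall_inner_eq e fun n => ?_⟩, hS, hS'⟩
  · rw [inner_sub_right, inner_diagonalOperator, key, ← inner_sub_right, add_sub_cancel_right]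
  · rw [hS', inner_sub_right, inner_diagonalOperator, inner_smul_right, ← sub_mul]
    push_cast
    exact inv_mul_cancel_left₀ (hne n) _

end Diagonal

/-! ### The resolvent of a block operator -/

section Coupled

variable {E : Type*} [NormedAddCommGroup E] [InnerProductSpace ℂ E]

/-- The block operator `(φ, ψ) ↦ (A φ + B ψ, B φ + Ω ψ)` with domain `D(A) × E`, for an unbounded
operator `A` and a bounded operator `B`. -/
def coupledOperator (A : E →ₗ.[ℂ] E) (B : E →L[ℂ] E) (Ω : ℝ) :
    WithLp 2 (E × E) →ₗ.[ℂ] WithLp 2 (E × E) where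
  domain := A.domain.comap (WithLp.fstₗ 2 ℂ _ _)
  toFun :=
    { toFun := fun Φ => WithLp.toLp 2
        (A ⟨Φ.1.fst, Φ.2⟩ + B Φ.1.snd, B Φ.1.fst + (Ω : ℂ) • Φ.1.snd)
      map_add' := by
        intro Φ Ψ
        have h : A ⟨(Φ + Ψ).1.fst, (Φ + Ψ).2⟩ = A ⟨Φ.1.fst, Φ.2⟩ + A ⟨Ψ.1.fst, Ψ.2⟩ :=
          A.map_add ⟨Φ.1.fst, Φ.2⟩ ⟨Ψ.1.fst, Ψ.2⟩
        rw [h, ← WithLp.toLp_add, Prod.mk_add_mk]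
        congr 2
        · rw [Submodule.coe_add, WithLp.add_snd, map_add]
          abel
        · rw [Submodule.coe_add, WithLp.add_snd, WithLp.add_fst, map_add, smul_add]
          abel
      map_smul' := by
        intro c Φ
        have h : A ⟨(c • Φ).1.fst, (c • Φ).2⟩ = c • A ⟨Φ.1.fst, Φ.2⟩ :=
          A.map_smul c ⟨Φ.1.fst, Φ.2⟩
        rw [h, RingHom.id_apply, ← WithLp.toLp_smul, Prod.smul_mk]
        congr 2
        · rw [Submodule.coe_smul, WithLp.smul_snd, map_smul, smul_add]
        · rw [Submodule.coe_smul, WithLp.smul_snd, WithLp.smul_fst, map_smul, smul_add,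
            smul_comm (Ω : ℂ) c] }

variable {A : E →ₗ.[ℂ] E} {B : E →L[ℂ] E} {Ω : ℝ}

lemma coupledOperator_fst (x : (coupledOperator A B Ω).domain) :
    (coupledOperator A B Ω x).fst = A ⟨(x : WithLp 2 (E × E)).fst, x.2⟩
      + B (x : WithLp 2 (E × E)).snd := rfl

lemma coupledOperator_snd (x : (coupledOperator A B Ω).domain) :
    (coupledOperator A B Ω x).snd = B (x : WithLp 2 (E × E)).fst
      + (Ω : ℂ) • (x : WithLp 2 (E × E)).snd := rfl

lemma prod_ext {F : Type*} {x y : WithLp 2 (F × F)} (h1 : x.fst = y.fst)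
    (h2 : x.snd = y.snd) : x = y :=
  WithLp.ofLp_injective 2 (Prod.ext h1 h2)

lemma coupledOperator_isFormalAdjoint (hA : A.IsFormalAdjoint A)
    (hB : (B : E →ₗ[ℂ] E).IsSymmetric) :
    (coupledOperator A B Ω).IsFormalAdjoint (coupledOperator A B Ω) := by
  intro x y
  have hB' : ∀ φ ψ, inner ℂ (B φ) ψ = inner ℂ φ (B ψ) := hB
  simp only [WithLp.prod_inner_apply, WithLp.ofLp_fst, WithLp.ofLp_snd, coupledOperator_fst,
    coupledOperator_snd, inner_add_left, inner_add_right, inner_smul_left, inner_smul_right,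
    Complex.conj_ofReal, hB',
    hA ⟨(x : WithLp 2 (E × E)).fst, x.2⟩ ⟨(y : WithLp 2 (E × E)).fst, y.2⟩]
  ring

/-- The resolvent of the block operator, obtained from that of `A` through the Schur complement:
`(H - μ)(φ, ψ) = (x₁, x₂)` means `ψ = c (x₂ - B φ)` and `(1 - c S B²) φ = S (x₁ - c B x₂)`, where
`S = (A - μ)⁻¹` and `c = (Ω - μ)⁻¹`. The second equation is solved by a Neumann series. -/
lemma exists_isResolvent_coupledOperator [CompleteSpace E] {μ : ℝ} (hμ : Ω - μ ≠ 0) {S : E →L[ℂ] E}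
    (hS : IsResolvent A (μ : ℂ) S) (hsmall : |Ω - μ|⁻¹ * ‖S‖ * (‖B‖ * ‖B‖) < 1) :
    ∃ R, IsResolvent (coupledOperator A B Ω) (μ : ℂ) R := by
  set c : ℂ := ((Ω - μ : ℝ) : ℂ)⁻¹ with hcdef
  have hc : (Ω - μ : ℂ) * c = 1 := by
    rw [hcdef, Complex.ofReal_sub]
    refine mul_inv_cancel₀ ?_
    exact_mod_cast hμ
  have hSmall : ‖c • (S * (B * B))‖ < 1 := by
    refine lt_of_le_of_lt ?_ hsmall
    rw [norm_smul, hcdef, norm_inv, Complex.norm_real, Real.norm_eq_abs, mul_assoc]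
    gcongr
    exact (norm_mul_le _ _).trans (mul_le_mul_of_nonneg_left (norm_mul_le _ _) (norm_nonneg _))
  obtain ⟨U, hU⟩ := isUnit_one_sub_of_norm_lt_one hSmall
  have hU1 : ∀ φ, (↑U⁻¹ : E →L[ℂ] E) φ - c • S (B (B ((↑U⁻¹ : E →L[ℂ] E) φ))) = φ := by
    intro φ
    have := congrArg (fun F : E →L[ℂ] E => F φ) U.mul_inv
    rw [hU] at this
    exact this
  have hU2 : ∀ φ, (↑U⁻¹ : E →L[ℂ] E) (φ - c • S (B (B φ))) = φ := by
    intro φ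
    have := congrArg (fun F : E →L[ℂ] E => F φ) U.inv_mul
    rw [hU] at this
    exact this
  let G : WithLp 2 (E × E) →L[ℂ] E :=
    (↑U⁻¹ : E →L[ℂ] E) ∘L S ∘L (WithLp.fstL 2 ℂ E E - c • (B ∘L WithLp.sndL 2 ℂ E E))
  let P : WithLp 2 (E × E) →L[ℂ] E := c • (WithLp.sndL 2 ℂ E E - B ∘L G)
  have hG : ∀ x, G x = (↑U⁻¹ : E →L[ℂ] E) (S (x.fst - c • B x.snd)) := fun x => rfl
  have hP : ∀ x, P x = c • (x.snd - B (G x)) := fun x => rfl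
  let R : WithLp 2 (E × E) →L[ℂ] WithLp 2 (E × E) :=
    (WithLp.prodContinuousLinearEquiv 2 ℂ E E).symm.toContinuousLinearMap ∘L (G.prod P)
  have hR1 : ∀ x, (R x).fst = G x := fun x => rfl
  have hR2 : ∀ x, (R x).snd = P x := fun x => rfl
  have hGS : ∀ x, S (x.fst - B (P x)) = G x := by
    intro x
    have h := hU1 (S (x.fst - c • B x.snd))
    rw [← hG, sub_eq_iff_eq_add] at h
    rw [h, hP, ← map_smul S, ← map_add]
    congr 1
    rw [map_smul, map_sub, smul_sub]
    abel
  refine ⟨R, fun x => ?_, fun y => ?_⟩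
  · obtain ⟨h, h'⟩ := hS.1 (x.fst - B (P x))
    simp only [hGS] at h h'
    refine ⟨h, prod_ext ?_ ?_⟩
    · rw [WithLp.sub_fst, WithLp.smul_fst, coupledOperator_fst]
      simp only [hR1, hR2]
      rw [add_sub_right_comm, h', sub_add_cancel]
    · rw [WithLp.sub_snd, WithLp.smul_snd, coupledOperator_snd]
      simp only [hR1, hR2]
      rw [add_sub_assoc, ← sub_smul, hP, smul_smul, hc, one_smul, add_sub_cancel]
  · set x := coupledOperator A B Ω y - (μ : ℂ) • (y : WithLp 2 (E × E)) with hx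
    have hx1 : x.fst = A ⟨(y : WithLp 2 (E × E)).fst, y.2⟩ - (μ : ℂ) • (y : WithLp 2 (E × E)).fst
        + B (y : WithLp 2 (E × E)).snd := by
      rw [hx, WithLp.sub_fst, WithLp.smul_fst, coupledOperator_fst]
      abel
    have hx2 : x.snd = B (y : WithLp 2 (E × E)).fst
        + (Ω - μ : ℂ) • (y : WithLp 2 (E × E)).snd := by
      rw [hx, WithLp.sub_snd, WithLp.smul_snd, coupledOperator_snd, sub_smul]
      abel
    have hGx : G x = (y : WithLp 2 (E × E)).fst := by
      rw [hG, hx1, hx2, map_add, map_smul, smul_add, smul_smul, mul_comm c, hc, one_smul,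
        add_sub_add_right_eq_sub, map_sub, hS.2 ⟨(y : WithLp 2 (E × E)).fst, y.2⟩, map_smul, hU2]
    refine prod_ext ((hR1 x).trans hGx) ((hR2 x).trans ?_)
    rw [hP, hGx, hx2, add_sub_cancel_left, smul_smul, mul_comm c, hc, one_smul]

/-- If `A` has compact resolvent, then the resolvent `R` of the block operator equals
`c = (Ω - μ)⁻¹` on the second component, up to a compact operator; hence `R (R - c)` is compact. -/
lemma isCompactOperator_resolvent_coupledOperator {μ : ℝ} (hμ : Ω - μ ≠ 0) {S : E →L[ℂ] E}
    (hS : IsResolvent A (μ : ℂ) S) (hScpt : IsCompactOperator S)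
    {R : WithLp 2 (E × E) →L[ℂ] WithLp 2 (E × E)}
    (hR : IsResolvent (coupledOperator A B Ω) (μ : ℂ) R) :
    IsCompactOperator (R ∘L R - (((Ω - μ)⁻¹ : ℝ) : ℂ) • R) := by
  set c : ℂ := (((Ω - μ)⁻¹ : ℝ) : ℂ) with hcdef
  have hc : c * (Ω - μ : ℂ) = 1 := by
    rw [hcdef, Complex.ofReal_inv, Complex.ofReal_sub]
    refine inv_mul_cancel₀ ?_
    exact_mod_cast hμ
  let I : E × E →L[ℂ] WithLp 2 (E × E) :=
    (WithLp.prodContinuousLinearEquiv 2 ℂ E E).symm.toContinuousLinearMap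
  let Q : WithLp 2 (E × E) →L[ℂ] WithLp 2 (E × E) :=
    I ∘L ((0 : WithLp 2 (E × E) →L[ℂ] E).prod (WithLp.sndL 2 ℂ E E))
  let F : WithLp 2 (E × E) →L[ℂ] E := WithLp.fstL 2 ℂ E E - B ∘L WithLp.sndL 2 ℂ E E ∘L R
  let J : E →L[ℂ] WithLp 2 (E × E) := I ∘L ((ContinuousLinearMap.id ℂ E).prod (-(c • B)))
  let K : WithLp 2 (E × E) →L[ℂ] WithLp 2 (E × E) := J ∘L S ∘L F
  have hK : IsCompactOperator K := (hScpt.comp_clm F).clm_comp J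
  have hRapp : ∀ x, R x = c • Q x + K x := by
    intro x
    obtain ⟨h, h'⟩ := hR.1 x
    have h1 : S (F x) = (R x).fst := by
      have h1 := congrArg WithLp.fst h'
      rw [WithLp.sub_fst, WithLp.smul_fst, coupledOperator_fst, add_sub_right_comm] at h1
      change S (x.fst - B (R x).snd) = _
      rw [← eq_sub_iff_add_eq.2 h1]
      exact hS.2 ⟨(R x).fst, h⟩
    refine prod_ext ?_ ?_
    · change (R x).fst = c • (0 : E) + S (F x)
      rw [h1, smul_zero, zero_add]
    · change (R x).snd = c • x.snd + -(c • B (S (F x)))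
      have h2 := congrArg WithLp.snd h'
      rw [WithLp.sub_snd, WithLp.smul_snd, coupledOperator_snd, add_sub_assoc, ← sub_smul] at h2
      rw [h1, ← sub_eq_add_neg, ← smul_sub, ← eq_sub_iff_add_eq'.2 h2, smul_smul, hc, one_smul]
  have hQQ : ∀ x, Q (Q x) = Q x := fun x => rfl
  have hT : R ∘L R - c • R = c • (K ∘L Q) + R ∘L K - c • K := by
    ext1 x
    change R (R x) - c • R x = c • K (Q x) + R (K x) - c • K x
    have h1 : R (R x) = c • (c • Q x + K (Q x)) + R (K x) := by
      conv_lhs => rw [hRapp x, map_add, map_smul, hRapp (Q x), hQQ]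
    rw [h1, hRapp x, smul_add, smul_add]
    abel
  rw [hT]
  exact (((hK.comp_clm Q).smul c).add (hK.clm_comp R)).sub (hK.smul c)

end Coupled

/-! ### The eigenbasis of a block operator -/

section Discreteness

variable {κ : Type*} {E : Type u} [NormedAddCommGroup E] [InnerProductSpace ℂ E] [CompleteSpace E]
  {e : HilbertBasis κ ℂ E} {α : κ → ℝ} {B : E →L[ℂ] E}

/-- Sufficiently negative numbers belong to the resolvent set of the block operator whose first
entry is diagonal with nonnegative entries tending to infinity. -/
lemma exists_forall_isResolvent (e : HilbertBasis κ ℂ E) (hα0 : ∀ m, 0 ≤ α m)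
    (hα : ∀ C, {m | α m ≤ C}.Finite) (B : E →L[ℂ] E) (Ω : ℝ) :
    ∃ μ₀ < Ω, ∀ μ ≤ μ₀, ∃ S : E →L[ℂ] E, IsResolvent (diagonalOperator e α) (μ : ℂ) S ∧
      IsCompactOperator S ∧
      ∃ R, IsResolvent (coupledOperator (diagonalOperator e α) B Ω) (μ : ℂ) R := by
  have hδ : 0 < ‖B‖ + 1 := by positivity
  refine ⟨min 0 Ω - (‖B‖ + 1), by linarith [min_le_right 0 Ω], fun μ hμ => ?_⟩
  have hμ0 : ‖B‖ + 1 ≤ -μ := by linarith [min_le_left 0 Ω]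
  have hμΩ : ‖B‖ + 1 ≤ Ω - μ := by linarith [min_le_right 0 Ω]
  obtain ⟨S, hS, hSn, hSe⟩ := exists_isResolvent_diagonalOperator e (α := α) (μ := μ) hδ
    fun n => by linarith [hα0 n]
  have hpos : ∀ n, 0 < α n - μ := fun n => by linarith [hα0 n]
  refine ⟨S, hS, isCompactOperator_of_diagonal e (fun ε hε => ?_) hSe,
    exists_isResolvent_coupledOperator (by linarith) hS ?_⟩
  · refine (hα (ε⁻¹ + μ)).subset fun n hn => ?_
    have hn : ε ≤ ‖((α n - μ : ℝ) : ℂ)⁻¹‖ := hn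
    rw [norm_inv, Complex.norm_real, Real.norm_of_nonneg (hpos n).le,
      le_inv_comm₀ hε (hpos n)] at hn
    exact sub_le_iff_le_add.1 hn
  · have h1 : |Ω - μ|⁻¹ ≤ (‖B‖ + 1)⁻¹ := inv_anti₀ hδ (hμΩ.trans (le_abs_self _))
    calc |Ω - μ|⁻¹ * ‖S‖ * (‖B‖ * ‖B‖)
        ≤ (‖B‖ + 1)⁻¹ * (‖B‖ + 1)⁻¹ * (‖B‖ * ‖B‖) := by gcongr
      _ = (‖B‖ / (‖B‖ + 1)) * (‖B‖ / (‖B‖ + 1)) := by ring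
      _ < 1 := mul_lt_one_of_nonneg_of_lt_one_left (by positivity)
          ((div_lt_one hδ).2 (lt_add_one _)) ((div_lt_one hδ).2 (lt_add_one _)).le

/-- The block operator has an orthonormal basis of eigenvectors, and its eigenvalues, which are
bounded below, accumulate at most at `Ω` and at infinity. -/
theorem exists_eigenbasis_coupledOperator (e : HilbertBasis κ ℂ E) (hα0 : ∀ m, 0 ≤ α m)
    (hα : ∀ C, {m | α m ≤ C}.Finite) (hB : (B : E →ₗ[ℂ] E).IsSymmetric) (Ω : ℝ) :
    ∃ (μ : ℝ) (R : WithLp 2 (E × E) →L[ℂ] WithLp 2 (E × E)) (ι : Type u)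
      (b : HilbertBasis ι ℂ (WithLp 2 (E × E))) (a : ι → ℝ),
      IsResolvent (coupledOperator (diagonalOperator e α) B Ω) (μ : ℂ) R ∧
      (∀ n, b n ∈ eigenspace (coupledOperator (diagonalOperator e α) B Ω) (a n : ℂ)) ∧
      (∀ n, μ < a n) ∧ ∀ C, ∀ δ > 0, {n | a n ≤ C ∧ δ ≤ |a n - Ω|}.Finite := by
  obtain ⟨μ, hμΩ, hres⟩ := exists_forall_isResolvent e hα0 hα B Ω
  obtain ⟨S, hS, hScpt, R, hR⟩ := hres μ le_rfl
  have hH := coupledOperator_isFormalAdjoint (Ω := Ω) (diagonalOperator_isFormalAdjoint e α) hB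
  have hΩμ : 0 < Ω - μ := sub_pos.2 hμΩ
  have hT := isCompactOperator_resolvent_coupledOperator hΩμ.ne' hS hScpt hR
  obtain ⟨ι, b, r, hb⟩ := exists_hilbertBasis_of_isCompactOperator (hR.isSymmetric hH) hR.injective
    _ hT
  have hr : ∀ n, r n ≠ 0 := fun n => (hR.mem_eigenspace (b.orthonormal.ne_zero n) (hb n)).1
  have hbH : ∀ n, b n ∈ eigenspace (coupledOperator (diagonalOperator e α) B Ω)
      ((μ + (r n)⁻¹ : ℝ) : ℂ) := fun n =>
    (hR.mem_eigenspace (b.orthonormal.ne_zero n) (hb n)).2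
  have hlt : ∀ n, μ < μ + (r n)⁻¹ := by
    intro n
    by_contra hle
    obtain ⟨-, -, -, R', hR'⟩ := hres _ (not_lt.1 hle)
    exact mem_spectrum_of_mem_eigenspace (hbH n) (b.orthonormal.ne_zero n) ⟨R', hR'⟩
  refine ⟨μ, R, ι, b, fun n => μ + (r n)⁻¹, hR, hbH, hlt, fun C δ hδ => ?_⟩
  have hTb : ∀ n, (R ∘L R - (((Ω - μ)⁻¹ : ℝ) : ℂ) • R) (b n) =
      ((r n * (r n - (Ω - μ)⁻¹) : ℝ) : ℂ) • b n := by
    intro n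
    change R (R (b n)) - (((Ω - μ)⁻¹ : ℝ) : ℂ) • R (b n) = _
    rw [hb, map_smul, hb, smul_smul, smul_smul, ← sub_smul]
    congr 1
    push_cast
    ring
  -- With `s = a - μ = r⁻¹`, the eigenvalue `r (r - c)` of `R (R - c)` is `c (Ω - a) / s²`.
  have hC : 0 < max C (μ + 1) - μ := by linarith [le_max_right C (μ + 1)]
  have hε : 0 < ((max C (μ + 1) - μ)⁻¹) ^ 2 * (Ω - μ)⁻¹ * δ := by positivity
  refine (finite_le_norm_eigenvalue b.orthonormal hT hTb hε).subset fun n hn => ?_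
  have hrpos : 0 < r n := by
    have := hlt n
    exact inv_pos.1 (by linarith)
  have h1 : (r n)⁻¹ ≤ max C (μ + 1) - μ := by
    have := hn.1
    linarith [le_max_left C (μ + 1)]
  have h2 : (max C (μ + 1) - μ)⁻¹ ≤ r n := (inv_le_comm₀ hrpos hC).1 h1
  have h3 : r n * (r n - (Ω - μ)⁻¹) = -((r n) ^ 2 * (Ω - μ)⁻¹ * (μ + (r n)⁻¹ - Ω)) := by
    field_simp [hr n]
    ring
  rw [Set.mem_ofPred_eq, Complex.norm_real, Real.norm_eq_abs, h3, abs_neg, abs_mul,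
    abs_of_pos (by positivity : 0 < (r n) ^ 2 * (Ω - μ)⁻¹)]
  gcongr
  exact hn.2

omit [CompleteSpace E] in
/-- If the form of a diagonal operator is at most `C` on a subspace `V` of its domain, then the
dimension of `V` is at most the number of entries `≤ C`: a vector of `V` whose coordinates at these
entries vanish is zero. -/
lemma finrank_le_of_form_le (e : HilbertBasis κ ℂ E) {C : ℝ} (hα : {m | α m ≤ C}.Finite)
    (V : Submodule ℂ E) (hV : ∀ z ∈ V, ∃ h : z ∈ (diagonalOperator e α).domain,
      (inner ℂ z (diagonalOperator e α ⟨z, h⟩)).re ≤ C * ‖z‖ ^ 2) :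
    FiniteDimensional ℂ V ∧ Module.finrank ℂ V ≤ hα.toFinset.card := by
  let L : V →ₗ[ℂ] (hα.toFinset → ℂ) := LinearMap.pi fun m =>
    (innerSL ℂ (e m)).toLinearMap ∘ₗ V.subtype
  have hL : Function.Injective L := by
    rw [injective_iff_map_eq_zero]
    intro z hz
    obtain ⟨h, hle⟩ := hV z z.2
    have h0 : ∀ m, α m ≤ C → inner ℂ (e m) (z : E) = 0 := fun m hm =>
      congrFun hz ⟨m, hα.mem_toFinset.2 hm⟩
    have h1 := (hasSum_re_inner_of_diagonal e
      fun n => inner_diagonalOperator e α ⟨(z : E), h⟩ n).sub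
      ((hasSum_normSq_inner e (z : E)).mul_left C)
    have hnn : ∀ m, 0 ≤ α m * ‖inner ℂ (e m) (z : E)‖ ^ 2 - C * ‖inner ℂ (e m) (z : E)‖ ^ 2 := by
      intro m
      rw [← sub_mul]
      by_cases hm : α m ≤ C
      · rw [h0 m hm]
        simp
      · exact mul_nonneg (sub_nonneg.2 (not_le.1 hm).le) (by positivity)
    have h2 : (inner ℂ (z : E) (diagonalOperator e α ⟨z, h⟩)).re - C * ‖(z : E)‖ ^ 2 = 0 :=
      le_antisymm (sub_nonpos.2 hle) (h1.nonneg hnn)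
    rw [h2, hasSum_zero_iff_of_nonneg hnn] at h1
    refine Subtype.ext (eq_of_forall_inner_eq e fun m => ?_)
    rw [ZeroMemClass.coe_zero, inner_zero_right]
    by_cases hm : α m ≤ C
    · exact h0 m hm
    · have h3 := congrFun h1 m
      simp only [Pi.zero_apply, ← sub_mul] at h3
      have h4 := (mul_eq_zero.1 h3).resolve_left (sub_pos.2 (not_le.1 hm)).ne'
      exact norm_eq_zero.1 (pow_eq_zero_iff two_ne_zero |>.1 h4)
  refine ⟨FiniteDimensional.of_injective L hL, ?_⟩
  have := LinearMap.finrank_le_finrank_of_injective hL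
  rwa [Module.finrank_fintype_fun_eq_card, Fintype.card_coe] at this

end Discreteness

/-! ### Counting eigenvalues on both sides of `Ω` -/

section Counting

variable {κ ι E : Type*} [NormedAddCommGroup E] [InnerProductSpace ℂ E]

section General

variable {A : E →ₗ.[ℂ] E} {B : E →L[ℂ] E} {Ω : ℝ}

lemma toLp_zero_mem_domain (ψ : E) :
    WithLp.toLp 2 ((0 : E), ψ) ∈ (coupledOperator A B Ω).domain :=
  A.domain.zero_mem

lemma coupledOperator_toLp_zero (ψ : E) :
    coupledOperator A B Ω ⟨WithLp.toLp 2 ((0 : E), ψ), toLp_zero_mem_domain ψ⟩ =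
      WithLp.toLp 2 (B ψ, (Ω : ℂ) • ψ) := by
  refine prod_ext ?_ ?_
  · rw [coupledOperator_fst]
    change A 0 + B ψ = B ψ
    rw [A.map_zero, zero_add]
  · rw [coupledOperator_snd]
    change B 0 + (Ω : ℂ) • ψ = (Ω : ℂ) • ψ
    rw [map_zero, zero_add]

/-- The form of `H - Ω` vanishes on vectors whose first component is zero; written in an
eigenbasis. -/
lemma hasSum_toLp_zero (hH : (coupledOperator A B Ω).IsFormalAdjoint (coupledOperator A B Ω))
    (b : HilbertBasis ι ℂ (WithLp 2 (E × E))) {a : ι → ℝ}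
    (hb : ∀ n, b n ∈ eigenspace (coupledOperator A B Ω) (a n : ℂ)) (ψ : E) :
    HasSum (fun n => (a n - Ω) * ‖inner ℂ (b n) (WithLp.toLp 2 ((0 : E), ψ))‖ ^ 2) 0 := by
  have h := hasSum_re_inner_of_diagonal b (c := fun n => a n - Ω)
    (x := WithLp.toLp 2 ((0 : E), ψ))
    (y := coupledOperator A B Ω ⟨WithLp.toLp 2 ((0 : E), ψ), toLp_zero_mem_domain ψ⟩
      - (Ω : ℂ) • WithLp.toLp 2 ((0 : E), ψ)) fun n => by
        rw [inner_sub_right, inner_apply_of_mem_eigenspace hH (hb n), inner_smul_right]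
        push_cast
        ring
  convert h using 1
  have h1 : WithLp.toLp 2 (B ψ, (Ω : ℂ) • ψ) - (Ω : ℂ) • WithLp.toLp 2 ((0 : E), ψ) =
      WithLp.toLp 2 (B ψ, (0 : E)) := by
    rw [← WithLp.toLp_smul, ← WithLp.toLp_sub]
    simp
  rw [coupledOperator_toLp_zero, h1]
  simp [WithLp.prod_inner_apply]

/-- If `B` has infinite rank, the block operator has infinitely many eigenvalues below `Ω`:
otherwise, the form of `H - Ω` would be nonnegative, hence zero, on a subspace of finite codimension
of `0 × E`, and `B` would vanish there. -/
lemma infinite_lt (hH : (coupledOperator A B Ω).IsFormalAdjoint (coupledOperator A B Ω))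
    (b : HilbertBasis ι ℂ (WithLp 2 (E × E))) {a : ι → ℝ}
    (hb : ∀ n, b n ∈ eigenspace (coupledOperator A B Ω) (a n : ℂ))
    (hB : ¬ FiniteDimensional ℂ (E ⧸ LinearMap.ker (B : E →ₗ[ℂ] E))) : {n | a n < Ω}.Infinite := by
  intro hfin
  have := hfin.fintype
  let L : E →ₗ[ℂ] ({n | a n < Ω} → ℂ) := LinearMap.pi fun n =>
    (innerSL ℂ (b n)).toLinearMap ∘ₗ (WithLp.linearEquiv 2 ℂ (E × E)).symm.toLinearMap ∘ₗ
      LinearMap.inr ℂ E E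
  have hker : LinearMap.ker L ≤ LinearMap.ker (B : E →ₗ[ℂ] E) := by
    intro ψ hψ
    have h0 : ∀ n, a n < Ω → inner ℂ (b n) (WithLp.toLp 2 ((0 : E), ψ)) = 0 := fun n hn =>
      congrFun (LinearMap.mem_ker.1 hψ) ⟨n, hn⟩
    have h1 := hasSum_toLp_zero hH b hb ψ
    rw [hasSum_zero_iff_of_nonneg] at h1
    · have h2 : coupledOperator A B Ω ⟨WithLp.toLp 2 ((0 : E), ψ), toLp_zero_mem_domain ψ⟩ =
          (Ω : ℂ) • WithLp.toLp 2 ((0 : E), ψ) := by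
        refine eq_of_forall_inner_eq b fun n => ?_
        rw [inner_apply_of_mem_eigenspace hH (hb n), inner_smul_right]
        rcases mul_eq_zero.1 (congrFun h1 n) with h | h
        · rw [sub_eq_zero.1 h]
        · rw [norm_eq_zero.1 (pow_eq_zero_iff two_ne_zero |>.1 h), mul_zero, mul_zero]
      rw [coupledOperator_toLp_zero] at h2
      have h3 := congrArg WithLp.fst h2
      rw [WithLp.smul_fst] at h3
      change B ψ = (Ω : ℂ) • (0 : E) at h3
      rw [LinearMap.mem_ker]
      exact h3.trans (smul_zero _)
    · intro n
      by_cases hn : a n < Ω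
      · simp [h0 n hn]
      · exact mul_nonneg (sub_nonneg.2 (not_lt.1 hn)) (by positivity)
  have : FiniteDimensional ℂ (E ⧸ LinearMap.ker L) :=
    L.quotKerEquivRange.symm.finiteDimensional
  exact hB (Module.Finite.of_surjective (Submodule.factor hker) (Submodule.factor_surjective hker))

/-- The eigenvalues above `Ω` are nonnegative if `A` is: if `H (φ, ψ) = ω (φ, ψ)`, then
`⟨φ, A φ⟩ + (ω - Ω) ‖ψ‖² = ω ‖φ‖²`. -/
lemma nonneg_of_lt (hB : (B : E →ₗ[ℂ] E).IsSymmetric)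
    (hA : ∀ φ : A.domain, 0 ≤ (inner ℂ (φ : E) (A φ)).re) {ω : ℝ} (hω : Ω < ω)
    {x : WithLp 2 (E × E)} (hx : x ∈ eigenspace (coupledOperator A B Ω) (ω : ℂ)) (hx0 : x ≠ 0) :
    0 ≤ ω := by
  obtain ⟨h, hx⟩ := mem_eigenspace_iff.1 hx
  have h1 : A ⟨x.fst, h⟩ + B x.snd = (ω : ℂ) • x.fst := congrArg WithLp.fst hx
  have h2 : B x.fst + (Ω : ℂ) • x.snd = (ω : ℂ) • x.snd := congrArg WithLp.snd hx
  have h2' : B x.fst = ((ω - Ω : ℝ) : ℂ) • x.snd := by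
    rw [eq_sub_iff_add_eq.2 h2, ← sub_smul, Complex.ofReal_sub]
  have h3 : inner ℂ x.fst (B x.snd) = ((ω - Ω : ℝ) : ℂ) * inner ℂ x.snd x.snd := by
    have : inner ℂ (B x.fst) x.snd = inner ℂ x.fst (B x.snd) := hB x.fst x.snd
    rw [← this, h2', inner_smul_left, Complex.conj_ofReal]
  have h4 := congrArg (fun y => (inner ℂ x.fst y).re) h1
  simp only [inner_add_right, h3, inner_smul_right, Complex.add_re, Complex.re_ofReal_mul] at h4
  have hn : ∀ y : E, (inner ℂ y y : ℂ).re = ‖y‖ ^ 2 := fun y => inner_self_eq_norm_sq (𝕜 := ℂ) y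
  rw [hn, hn] at h4
  have h5 := hA ⟨x.fst, h⟩
  have h6 : 0 ≤ (ω - Ω) * ‖x.snd‖ ^ 2 := mul_nonneg (sub_pos.2 hω).le (by positivity)
  have hne : 0 < ‖x.fst‖ ^ 2 := by
    refine pow_pos (norm_pos_iff.2 fun h0 => hx0 ?_) 2
    refine prod_ext h0 ?_
    rw [h0, map_zero, eq_comm, smul_eq_zero] at h2'
    refine h2'.resolve_left ?_
    exact_mod_cast (sub_pos.2 hω).ne'
  by_contra hneg
  nlinarith [not_le.1 hneg]

lemma eigenspace_eq_bot_of_injective (hB : Function.Injective B) :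
    eigenspace (coupledOperator A B Ω) (Ω : ℂ) = ⊥ := by
  rw [Submodule.eq_bot_iff]
  intro x hx
  obtain ⟨h, hx⟩ := mem_eigenspace_iff.1 hx
  have h1 : A ⟨x.fst, h⟩ + B x.snd = (Ω : ℂ) • x.fst := congrArg WithLp.fst hx
  have h2 : B x.fst + (Ω : ℂ) • x.snd = (Ω : ℂ) • x.snd := congrArg WithLp.snd hx
  have h3 : x.fst = 0 := (map_eq_zero_iff B hB).1 (add_eq_right.1 h2)
  have h4 : (⟨x.fst, h⟩ : A.domain) = 0 := Subtype.ext h3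
  rw [h4, A.map_zero, zero_add, h3, smul_zero, map_eq_zero_iff B hB] at h1
  exact prod_ext h3 h1

end General

variable {e : HilbertBasis κ ℂ E} {α : κ → ℝ} {B : E →L[ℂ] E} {Ω : ℝ}

lemma hasSum_form {X : Type*} [NormedAddCommGroup X] [InnerProductSpace ℂ X] {H : X →ₗ.[ℂ] X}
    (hH : H.IsFormalAdjoint H) (b : HilbertBasis ι ℂ X) {a : ι → ℝ}
    (hb : ∀ n, b n ∈ eigenspace H (a n : ℂ)) (x : H.domain) :
    HasSum (fun n => a n * ‖inner ℂ (b n) (x : X)‖ ^ 2) (inner ℂ (x : X) (H x)).re :=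
  hasSum_re_inner_of_diagonal b fun n => inner_apply_of_mem_eigenspace hH (hb n) x

lemma inner_coupledOperator_of_snd_eq_zero {A : E →ₗ.[ℂ] E} {φ : E} (hφ : φ ∈ A.domain) :
    inner ℂ (WithLp.toLp 2 (φ, (0 : E)))
      (coupledOperator A B Ω ⟨WithLp.toLp 2 (φ, (0 : E)), hφ⟩) = inner ℂ φ (A ⟨φ, hφ⟩) := by
  have h1 : (coupledOperator A B Ω ⟨WithLp.toLp 2 (φ, (0 : E)), hφ⟩).fst = A ⟨φ, hφ⟩ + B 0 := rfl
  rw [WithLp.prod_inner_apply, WithLp.ofLp_fst, WithLp.ofLp_fst, WithLp.ofLp_snd, WithLp.ofLp_snd,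
    h1]
  simp

omit [InnerProductSpace ℂ E] in
lemma norm_sq_toLp_zero_right (φ : E) : ‖WithLp.toLp 2 (φ, (0 : E))‖ ^ 2 = ‖φ‖ ^ 2 := by
  rw [WithLp.prod_norm_sq_eq_of_L2]
  simp

/-- The block operator has infinitely many eigenvalues above `Ω` since its form is unbounded above
on `D(A) × 0`. -/
lemma infinite_gt
    (hH : (coupledOperator (diagonalOperator e α) B Ω).IsFormalAdjoint
      (coupledOperator (diagonalOperator e α) B Ω))
    (hα : ∀ C, ∃ m, C < α m) (b : HilbertBasis ι ℂ (WithLp 2 (E × E))) {a : ι → ℝ}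
    (hb : ∀ n, b n ∈ eigenspace (coupledOperator (diagonalOperator e α) B Ω) (a n : ℂ)) :
    {n | Ω < a n}.Infinite := by
  intro hfin
  obtain ⟨C, hC⟩ := (hfin.image a).bddAbove
  obtain ⟨m, hm⟩ := hα (max C Ω)
  obtain ⟨hdom, heig⟩ := mem_eigenspace_iff.1 (basis_mem_eigenspace e α m)
  have h1 := hasSum_form hH b hb ⟨WithLp.toLp 2 (e m, (0 : E)), hdom⟩
  have h2 := (hasSum_normSq_inner b (WithLp.toLp 2 (e m, (0 : E)))).mul_left (max C Ω)
  rw [inner_coupledOperator_of_snd_eq_zero hdom, heig, inner_smul_right, Complex.re_ofReal_mul,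
    show (inner ℂ (e m) (e m) : ℂ).re = ‖e m‖ ^ 2 from inner_self_eq_norm_sq (𝕜 := ℂ) _,
    e.orthonormal.1] at h1
  rw [norm_sq_toLp_zero_right, e.orthonormal.1] at h2
  have h3 := hasSum_le (fun n => mul_le_mul_of_nonneg_right ?_ (by positivity)) h1 h2
  · linarith
  · rcases lt_or_ge Ω (a n) with h | h
    · exact (hC ⟨n, h, rfl⟩).trans (le_max_left _ _)
    · exact h.trans (le_max_right _ _)

/-- A dimension count: some nonzero combination of `m` vectors of a basis is orthogonal to a given
space of dimension less than `m`. -/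
lemma exists_combination_orthogonal {X : Type*} [NormedAddCommGroup X] [InnerProductSpace ℂ X]
    (b : HilbertBasis ι ℂ X) (s : Finset ι) (Z : Submodule ℂ X) [FiniteDimensional ℂ Z]
    (hZ : Module.finrank ℂ Z < s.card) :
    ∃ Φ : X, (∀ n ∉ s, inner ℂ (b n) Φ = 0) ∧ ∃ n₁ ∈ s, inner ℂ (b n₁) Φ ≠ 0 ∧
      ∀ z ∈ Z, inner ℂ z Φ = 0 := by
  classical
  let F : (s → ℂ) →ₗ[ℂ] X := Fintype.linearCombination ℂ fun n : s => b n
  have hF : ∀ c n, inner ℂ (b n) (F c) = if h : n ∈ s then c ⟨n, h⟩ else 0 := by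
    intro c n
    simp only [F, Fintype.linearCombination_apply, inner_sum, inner_smul_right,
      orthonormal_iff_ite.1 b.orthonormal]
    split_ifs with h
    · rw [Finset.sum_eq_single ⟨n, h⟩]
      · simp
      · intro m _ hm
        rw [if_neg (fun hnm => hm (Subtype.ext hnm.symm)), mul_zero]
      · simp
    · refine Finset.sum_eq_zero fun m _ => ?_
      rw [if_neg (fun hnm : n = m => h (hnm ▸ m.2)), mul_zero]
  let zb := Module.finBasis ℂ Z
  let G : (s → ℂ) →ₗ[ℂ] (Fin (Module.finrank ℂ Z) → ℂ) := LinearMap.pi fun i =>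
    (innerSL ℂ (zb i : X)).toLinearMap ∘ₗ F
  have hGker : LinearMap.ker G ≠ ⊥ := by
    refine LinearMap.ker_ne_bot_of_finrank_lt ?_
    rw [Module.finrank_fintype_fun_eq_card, Module.finrank_fintype_fun_eq_card, Fintype.card_fin,
      Fintype.card_coe]
    exact hZ
  obtain ⟨c, hc, hc0⟩ := Submodule.exists_mem_ne_zero_of_ne_bot hGker
  obtain ⟨n₁, hn₁⟩ := Function.ne_iff.1 hc0
  refine ⟨F c, fun n hn => by rw [hF, dif_neg hn], n₁, n₁.2, ?_, fun z hz => ?_⟩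
  · rw [hF, dif_pos n₁.2]
    exact hn₁
  · have h1 : ∀ i, inner ℂ (zb i : X) (F c) = 0 := fun i => congrFun (LinearMap.mem_ker.1 hc) i
    have h2 := congrArg (fun w : Z => inner ℂ (w : X) (F c)) (zb.sum_repr ⟨z, hz⟩)
    simp only [Submodule.coe_sum, Submodule.coe_smul, sum_inner,
      inner_smul_left, h1, mul_zero, Finset.sum_const_zero] at h2
    exact h2.symm

/-- The bounded function `(ν ↦ ν - τ) · 1_{(-∞, C]}` of an operator that is bounded below. -/
lemma exists_truncation {X : Type*} [NormedAddCommGroup X] [InnerProductSpace ℂ X]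
    (b : HilbertBasis ι ℂ X) {a : ι → ℝ} {μ : ℝ} (ha : ∀ n, μ < a n) (C τ : ℝ) :
    ∃ D : X →L[ℂ] X, ∀ x n,
      inner ℂ (b n) (D x) = ((if a n ≤ C then a n - τ else 0 : ℝ) : ℂ) * inner ℂ (b n) x := by
  obtain ⟨D, -, hD⟩ := exists_diagonal b
    (fun n => ((if a n ≤ C then a n - τ else 0 : ℝ) : ℂ)) (M := |μ - τ| + |C - τ|)
    (by positivity) fun n => by
      rw [Complex.norm_real, Real.norm_eq_abs]
      split_ifs with h
      · refine abs_le.2 ⟨?_, ?_⟩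
        · linarith [ha n, neg_abs_le (μ - τ), abs_nonneg (C - τ)]
        · linarith [le_abs_self (C - τ), abs_nonneg (μ - τ)]
      · rw [abs_zero]
        positivity
  exact ⟨D, hD⟩

/-- A spectral subspace on which the operator is bounded lies in its domain. -/
lemma mem_domain_of_forall_inner_eq_zero {X : Type*} [NormedAddCommGroup X]
    [InnerProductSpace ℂ X] {H : X →ₗ.[ℂ] X} (hH : H.IsFormalAdjoint H) {μ : ℝ} {R : X →L[ℂ] X}
    (hR : IsResolvent H (μ : ℂ) R) (b : HilbertBasis ι ℂ X) {a : ι → ℝ}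
    (hb : ∀ n, b n ∈ eigenspace H (a n : ℂ)) (ha : ∀ n, μ < a n) {C : ℝ} {x : X}
    (hx : ∀ n, C < a n → inner ℂ (b n) x = 0) : x ∈ H.domain := by
  obtain ⟨D, hD⟩ := exists_truncation b ha C μ
  obtain ⟨h, h'⟩ := hR.1 (D x)
  have hRx : R (D x) = x := by
    refine eq_of_forall_inner_eq b fun n => ?_
    have h1 := congrArg (inner ℂ (b n)) h'
    have hne : (a n : ℂ) - μ ≠ 0 := by exact_mod_cast (sub_pos.2 (ha n)).ne'
    rw [inner_sub_right, inner_apply_of_mem_eigenspace hH (hb n), inner_smul_right, hD,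
      ← sub_mul] at h1
    refine mul_left_cancel₀ hne (h1.trans ?_)
    split_ifs with hn
    · push_cast
      rfl
    · rw [hx n (not_le.1 hn), mul_zero, mul_zero]
  rwa [hRx] at h

/-- Eigenvalues do not accumulate at `Ω` from above. Let `Y` be the spectral subspace of `H` for
`(-∞, C]`. The vectors `(φ, 0) ∈ Y` form a finite-dimensional space, as `⟨φ, A φ⟩ ≤ C ‖φ‖²` for
them. If there were too many eigenvalues in `(Ω, C]`, some combination `Φ ≠ 0` of their eigenvectors
would be orthogonal to these vectors, hence would lie in the closure of the projection of `0 × E` to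
`Y`. As the form of `H - Ω` is positive at `Φ` and on `Yᗮ`, it would be positive at some vector of
`0 × E`, where it vanishes. -/
lemma finite_gt_le [CompleteSpace E]
    (hH : (coupledOperator (diagonalOperator e α) B Ω).IsFormalAdjoint
      (coupledOperator (diagonalOperator e α) B Ω))
    (hα : ∀ C, {m | α m ≤ C}.Finite) {μ : ℝ} {R : WithLp 2 (E × E) →L[ℂ] WithLp 2 (E × E)}
    (hR : IsResolvent (coupledOperator (diagonalOperator e α) B Ω) (μ : ℂ) R)
    (b : HilbertBasis ι ℂ (WithLp 2 (E × E))) {a : ι → ℝ}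
    (hb : ∀ n, b n ∈ eigenspace (coupledOperator (diagonalOperator e α) B Ω) (a n : ℂ))
    (ha : ∀ n, μ < a n) (C : ℝ) : {n | Ω < a n ∧ a n ≤ C}.Finite := by
  classical
  by_contra hinf
  obtain ⟨s, hs, hscard⟩ := Set.Infinite.exists_subset_card_eq hinf ((hα C).toFinset.card + 1)
  obtain ⟨n₀, hn₀⟩ : s.Nonempty := Finset.card_pos.1 (by omega)
  have hΩC : Ω ≤ C := (hs hn₀).1.le.trans (hs hn₀).2
  -- the spectral projection `P` onto `Y`
  obtain ⟨P, -, hP⟩ := exists_diagonal b (fun n => if a n ≤ C then 1 else 0) zero_le_one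
    fun n => by split_ifs <;> simp
  -- the space of all `φ` with `(φ, 0) ∈ Y`
  let ι₁ : E →ₗ[ℂ] WithLp 2 (E × E) :=
    (WithLp.linearEquiv 2 ℂ (E × E)).symm.toLinearMap ∘ₗ LinearMap.inl ℂ E E
  let Z : Submodule ℂ E :=
    ⨅ n : {n // C < a n}, LinearMap.ker ((innerSL ℂ (b n)).toLinearMap ∘ₗ ι₁)
  have hZ : ∀ φ, φ ∈ Z ↔ ∀ n, C < a n → inner ℂ (b n) (WithLp.toLp 2 (φ, (0 : E))) = 0 := by
    intro φ
    rw [Submodule.mem_iInf]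
    exact ⟨fun h n hn => h ⟨n, hn⟩, fun h n => h n n.2⟩
  obtain ⟨hZfin, hZrank⟩ := finrank_le_of_form_le e (hα C) Z fun z hz => by
    rw [hZ] at hz
    have hdom' : WithLp.toLp 2 (z, (0 : E)) ∈ (coupledOperator (diagonalOperator e α) B Ω).domain :=
      mem_domain_of_forall_inner_eq_zero hH hR b hb ha hz
    have hdom : z ∈ (diagonalOperator e α).domain := hdom'
    refine ⟨hdom, ?_⟩
    have h1 := hasSum_form hH b hb ⟨WithLp.toLp 2 (z, (0 : E)), hdom⟩
    have h2 := (hasSum_normSq_inner b (WithLp.toLp 2 (z, (0 : E)))).mul_left C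
    rw [inner_coupledOperator_of_snd_eq_zero hdom] at h1
    rw [norm_sq_toLp_zero_right] at h2
    refine hasSum_le (fun n => ?_) h1 h2
    by_cases hn : a n ≤ C
    · exact mul_le_mul_of_nonneg_right hn (by positivity)
    · simp [hz n (not_le.1 hn)]
  -- the combination `Φ`
  obtain ⟨Φ, hΦ, n₁, hn₁, hΦZ⟩ : ∃ Φ : WithLp 2 (E × E), (∀ n ∉ s, inner ℂ (b n) Φ = 0) ∧
      ∃ n₁ ∈ s, inner ℂ (b n₁) Φ ≠ 0 ∧
      ∀ z ∈ Z, inner ℂ (WithLp.toLp 2 (z, (0 : E))) Φ = 0 := by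
    have h1 : Module.finrank ℂ (Z.map ι₁) < s.card := by
      have := Submodule.finrank_map_le ι₁ Z
      omega
    obtain ⟨Φ, hΦ, n₁, hn₁, hn₁', hΦZ⟩ := exists_combination_orthogonal b s (Z.map ι₁) h1
    exact ⟨Φ, hΦ, n₁, hn₁, hn₁', fun z hz => hΦZ _ ⟨z, hz, rfl⟩⟩
  obtain ⟨hn₁', hΦZ⟩ := hΦZ
  let ι₂ : E →ₗ[ℂ] WithLp 2 (E × E) :=
    (WithLp.linearEquiv 2 ℂ (E × E)).symm.toLinearMap ∘ₗ LinearMap.inr ℂ E E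
  have hPsymm : ∀ x y, inner ℂ (P x) y = inner ℂ x (P y) := by
    intro x y
    rw [← b.tsum_inner_mul_inner, ← b.tsum_inner_mul_inner]
    refine tsum_congr fun n => ?_
    rw [hP, ← inner_conj_symm, hP, ← inner_conj_symm x]
    split_ifs <;> simp
  have hPΦ : P Φ = Φ := by
    refine eq_of_forall_inner_eq b fun n => ?_
    rw [hP]
    split_ifs with h
    · rw [one_mul]
    · rw [hΦ n fun hn => h (hs hn).2, zero_mul]
  have hclosure : Φ ∈
      (LinearMap.range ((P : WithLp 2 (E × E) →ₗ[ℂ] _) ∘ₗ ι₂)).topologicalClosure := by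
    rw [← Submodule.orthogonal_orthogonal_eq_closure]
    intro u hu
    have hsnd : (P u).snd = 0 := by
      have h1 : inner ℂ (ι₂ (P u).snd) (P u) = 0 := by
        rw [← hPsymm]
        exact hu _ ⟨_, rfl⟩
      have h2 : inner ℂ (ι₂ (P u).snd) (P u) = inner ℂ (P u).snd (P u).snd := by
        rw [WithLp.prod_inner_apply]
        change inner ℂ (0 : E) _ + inner ℂ (P u).snd (P u).snd = _
        rw [inner_zero_left, zero_add]
      rw [h2] at h1
      exact inner_self_eq_zero.1 h1
    have hPu : P u = WithLp.toLp 2 ((P u).fst, (0 : E)) := prod_ext rfl hsnd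
    rw [← hPΦ, ← hPsymm, hPu]
    refine hΦZ _ ((hZ _).2 fun n hn => ?_)
    rw [← hPu, hP, if_neg (not_le.2 hn), zero_mul]
  obtain ⟨D, hD⟩ := exists_truncation b ha C Ω
  have hDsum := fun y => hasSum_re_inner_of_diagonal b (hD y)
  have hcont : Continuous fun y : WithLp 2 (E × E) => (inner ℂ y (D y)).re :=
    Complex.continuous_re.comp (continuous_id.inner D.continuous)
  have hpos : 0 < (inner ℂ Φ (D Φ)).re := by
    refine (hDsum Φ).tsum_eq ▸ (hDsum Φ).summable.tsum_pos (fun n => ?_) n₁ ?_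
    · by_cases hn : n ∈ s
      · rw [if_pos (hs hn).2]
        exact mul_nonneg (sub_pos.2 (hs hn).1).le (by positivity)
      · simp [hΦ n hn]
    · rw [if_pos (hs hn₁).2]
      exact mul_pos (sub_pos.2 (hs hn₁).1) (pow_pos (norm_pos_iff.2 hn₁') 2)
  obtain ⟨-, hψ, ψ, rfl⟩ := mem_closure_iff.1 hclosure _ (isOpen_lt continuous_const hcont) hpos
  have h0 := hasSum_toLp_zero hH b hb ψ
  have h1 := hasSum_le (fun n => ?_) (hDsum (P (ι₂ ψ))) h0
  · exact absurd hψ (not_lt.2 h1)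
  · rw [hP]
    change _ * ‖_ * inner ℂ (b n) (WithLp.toLp 2 ((0 : E), ψ))‖ ^ 2 ≤ _
    split_ifs with hn
    · rw [one_mul]
    · rw [zero_mul]
      exact mul_nonneg (sub_nonneg.2 (hΩC.trans (not_le.1 hn).le)) (by positivity)

end Counting

/-! ### The spectral theorem for the block operator -/

section Enumeration

/-- An infinite family of reals with finite initial segments can be enumerated in nondecreasing
order. -/
lemma exists_monotone_enumeration {ι : Type*} [Infinite ι] (f : ι → ℝ)
    (hf : ∀ m, {n | f n ≤ f m}.Finite) : ∃ e : ℕ ≃ ι, Monotone (f ∘ e) := by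
  classical
  -- Ties are broken by an arbitrary linear order of the index set.
  let _ : LinearOrder ι := IsWellOrder.linearOrder WellOrderingRel
  let g : ι → ℝ ×ₗ ι := fun n => toLex (f n, n)
  have hg : Function.Injective g := fun m n h => congrArg (fun p => (ofLex p).2) h
  have hfst : ∀ m n, g m ≤ g n → f m ≤ f n := fun m n h => Prod.Lex.monotone_fst_ofLex h
  let E : ι ≃ Set.range g := Equiv.ofInjective g hg
  have hIic : ∀ y : Set.range g, (Set.Iic y).Finite := by
    intro y
    refine ((hf (E.symm y)).image E).subset fun z hz => ⟨E.symm z, ?_, E.apply_symm_apply z⟩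
    refine hfst _ _ ?_
    have h1 : ∀ z, g (E.symm z) = (z : ℝ ×ₗ ι) := fun z =>
      congrArg Subtype.val (E.apply_symm_apply z)
    rw [h1, h1]
    exact hz
  have : Infinite (Set.range g) := E.infinite_iff.1 inferInstance
  let _ : LocallyFiniteOrder (Set.range g) := LocallyFiniteOrder.ofFiniteIcc fun x y =>
    (hIic y).subset Set.Icc_subset_Iic_self
  have : NoMaxOrder (Set.range g) := by
    refine ⟨fun x => ?_⟩
    by_contra! h
    exact Set.infinite_univ ((hIic x).subset fun z _ => h z)
  obtain ⟨y₀⟩ : Nonempty (Set.range g) := inferInstance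
  obtain ⟨m, hm⟩ := (hIic y₀).exists_minimal ⟨y₀, Set.mem_Iic.2 le_rfl⟩
  let _ : OrderBot (Set.range g) :=
    { bot := m
      bot_le := fun z => by
        rcases le_total z y₀ with h | h
        · exact (le_total m z).elim id fun hzm => hm.2 h hzm
        · exact (Set.mem_Iic.1 hm.1).trans h }
  let _ : SuccOrder (Set.range g) := LinearLocallyFiniteOrder.succOrder _
  let _ : PredOrder (Set.range g) := LinearLocallyFiniteOrder.predOrder _
  let O : Set.range g ≃o ℕ := orderIsoNatOfLinearSuccPredArch
  refine ⟨O.symm.toEquiv.trans E.symm, fun i j hij => hfst _ _ ?_⟩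
  have h1 : ∀ z, g (E.symm z) = (z : ℝ ×ₗ ι) := fun z =>
    congrArg Subtype.val (E.apply_symm_apply z)
  change g (E.symm (O.symm i)) ≤ g (E.symm (O.symm j))
  rw [h1, h1]
  exact O.symm.monotone hij

end Enumeration

section Spectrum

variable {κ : Type*} {E : Type u} [NormedAddCommGroup E] [InnerProductSpace ℂ E] [CompleteSpace E]

/-- The spectral theorem for the block operator `(φ, ψ) ↦ (A φ + B ψ, B φ + Ω ψ)`, for a diagonal
operator `A` with nonnegative entries tending to infinity and a bounded symmetric operator `B` of
infinite rank. -/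
theorem spectrum_coupledOperator (e : HilbertBasis κ ℂ E) {α : κ → ℝ} (hα0 : ∀ m, 0 ≤ α m)
    (hα : ∀ C, {m | α m ≤ C}.Finite) (hα' : ∀ C, ∃ m, C < α m) {B : E →L[ℂ] E}
    (hB : (B : E →ₗ[ℂ] E).IsSymmetric)
    (hBrank : ¬ FiniteDimensional ℂ (E ⧸ LinearMap.ker (B : E →ₗ[ℂ] E)))
    (Ω : ℝ) {H : WithLp 2 (E × E) →ₗ.[ℂ] WithLp 2 (E × E)}
    (hHdef : H = coupledOperator (diagonalOperator e α) B Ω) :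
    (∀ z ∈ spectrum H, z ≠ (Ω : ℂ) → z.im = 0 ∧ IsDiscreteEigenvalue H z) ∧
    ∃ ωp ωm : ℕ → ℝ,
      (Monotone ωp ∧ (∀ j, 0 ≤ ωp j) ∧ Filter.Tendsto ωp Filter.atTop Filter.atTop ∧
        {ω : ℝ | (ω : ℂ) ∈ spectrum H ∧ Ω < ω} = Set.range ωp) ∧
      (Monotone ωm ∧ Filter.Tendsto ωm Filter.atTop (nhds Ω) ∧
        {ω : ℝ | (ω : ℂ) ∈ spectrum H ∧ ω < Ω} = Set.range ωm) ∧
      ∃ (ι : Type u) (b : HilbertBasis (ℕ ⊕ ℕ ⊕ ι) ℂ (WithLp 2 (E × E))),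
        (∀ j, b (Sum.inl j) ∈ eigenspace H (ωp j : ℂ)) ∧
        (∀ j, b (Sum.inr (Sum.inl j)) ∈ eigenspace H (ωm j : ℂ)) ∧
        (∀ i, b (Sum.inr (Sum.inr i)) ∈ eigenspace H (Ω : ℂ)) ∧
        (Function.Injective B → IsEmpty ι) := by
  obtain ⟨μ, R, κ', b, a, hR, hb, hμ, hfin⟩ := exists_eigenbasis_coupledOperator e hα0 hα hB Ω
  have hH := coupledOperator_isFormalAdjoint (Ω := Ω) (diagonalOperator_isFormalAdjoint e α) hB
  have hgt := infinite_gt hH hα' b hb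
  have hlt := infinite_lt hH b hb hBrank
  have hgtfin := finite_gt_le hH hα hR b hb hμ
  have hnonneg : ∀ n, Ω < a n → 0 ≤ a n := fun n hn => by
    refine nonneg_of_lt hB (fun φ => ?_) hn (hb n) (b.orthonormal.ne_zero n)
    exact (hasSum_re_inner_of_diagonal e (inner_diagonalOperator e α φ)).nonneg fun m =>
      mul_nonneg (hα0 m) (by positivity)
  have hspec : ∀ n, (a n : ℂ) ∈ spectrum H := fun n => by
    rw [hHdef]
    exact mem_spectrum_of_mem_eigenspace (hb n) (b.orthonormal.ne_zero n)
  have hdisc : ∀ z ∈ spectrum H, z ≠ (Ω : ℂ) → (∃ n, z = a n) ∧ IsDiscreteEigenvalue H z := by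
    intro z hz hzΩ
    rw [hHdef] at hz ⊢
    have hε : 0 < ‖z - Ω‖ / 2 := half_pos (norm_pos_iff.2 (sub_ne_zero.2 hzΩ))
    refine isDiscreteEigenvalue_of_eigenbasis hH hR b hb hε ?_ hz
    refine (hfin (‖z‖ + ‖z - Ω‖ / 2) _ hε).subset fun n hn => ?_
    have hn : ‖(a n : ℂ) - z‖ < ‖z - Ω‖ / 2 := hn
    constructor
    · have h1 : a n ≤ ‖(a n : ℂ)‖ := by
        rw [Complex.norm_real]
        exact le_abs_self _
      have h2 := norm_sub_norm_le (a n : ℂ) z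
      linarith
    · have h1 : |a n - Ω| = ‖(a n : ℂ) - Ω‖ := by
        rw [← Complex.ofReal_sub, Complex.norm_real, Real.norm_eq_abs]
      have h2 := norm_sub_le_norm_sub_add_norm_sub z (a n : ℂ) (Ω : ℂ)
      rw [norm_sub_rev z (a n : ℂ)] at h2
      linarith
  have hofReal : ∀ ω : ℝ, ω ≠ Ω → (ω : ℂ) ∈ spectrum H → ∃ n, a n = ω := by
    intro ω hω hz
    obtain ⟨n, hn⟩ := (hdisc ω hz (by exact_mod_cast hω)).1
    exact ⟨n, (by exact_mod_cast hn.symm)⟩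
  have := hgt.to_subtype
  have := hlt.to_subtype
  obtain ⟨ep, hep⟩ := exists_monotone_enumeration (fun n : {n | Ω < a n} => a n) fun m =>
    ((hgtfin (a m)).preimage (f := ((↑) : {n | Ω < a n} → κ')) Subtype.val_injective.injOn).subset
      fun n hn => ⟨n.2, hn⟩
  obtain ⟨em, hem⟩ := exists_monotone_enumeration (fun n : {n | a n < Ω} => a n) fun m =>
    ((hfin (a m) (Ω - a m) (sub_pos.2 m.2)).preimage (f := ((↑) : {n | a n < Ω} → κ'))
      Subtype.val_injective.injOn).subset fun n hn => by
        have hn : a n ≤ a m := hn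
        refine ⟨hn, ?_⟩
        rw [abs_sub_comm]
        exact (sub_le_sub_left hn Ω).trans (le_abs_self _)
  let σ : (ℕ ⊕ ℕ ⊕ {n | a n = Ω}) → κ' := Sum.elim (fun j => (ep j : κ'))
    (Sum.elim (fun j => (em j : κ')) fun i => (i : κ'))
  have hσ1 : ∀ j, Ω < a (ep j) := fun j => (ep j).2
  have hσ2 : ∀ j, a (em j) < Ω := fun j => (em j).2
  have hσinj : Function.Injective σ := by
    refine Function.Injective.sumElim (Subtype.val_injective.comp ep.injective)
      (Function.Injective.sumElim (Subtype.val_injective.comp em.injective) Subtype.val_injective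
        fun j i h => (hσ2 j).ne (h ▸ i.2)) ?_
    rintro j (i | i) h
    · exact lt_asymm (hσ1 j) ((congrArg a h).trans_lt (hσ2 i))
    · exact (hσ1 j).ne' ((congrArg a h).trans i.2)
  have hσsurj : Function.Surjective σ := by
    intro n
    rcases lt_trichotomy (a n) Ω with h | h | h
    · exact ⟨Sum.inr (Sum.inl (em.symm ⟨n, h⟩)), by simp [σ]⟩
    · exact ⟨Sum.inr (Sum.inr ⟨n, h⟩), rfl⟩
    · exact ⟨Sum.inl (ep.symm ⟨n, h⟩), by simp [σ]⟩
  have hsp : (Submodule.span ℂ (Set.range (b ∘ σ)))ᗮ = ⊥ := by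
    rw [hσsurj.range_comp, ← Submodule.orthogonal_closure, b.dense_span,
      Submodule.top_orthogonal_eq_bot]
  refine ⟨fun z hz hzΩ => ?_, fun j => a (ep j), fun j => a (em j),
    ⟨hep, fun j => hnonneg _ (hσ1 j), ?_, ?_⟩, ⟨hem, ?_, ?_⟩, {n | a n = Ω},
    HilbertBasis.mkOfOrthogonalEqBot (b.orthonormal.comp σ hσinj) hsp, ?_⟩
  · obtain ⟨⟨n, hn⟩, h⟩ := hdisc z hz hzΩ
    exact ⟨by rw [hn, Complex.ofReal_im], h⟩
  · refine Filter.tendsto_atTop.2 fun C => ?_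
    rw [← Nat.cofinite_eq_atTop, Filter.eventually_cofinite]
    refine ((hgtfin C).preimage (f := fun j => (ep j : κ'))
      (Subtype.val_injective.comp ep.injective).injOn).subset fun j hj => ?_
    exact ⟨hσ1 j, (not_le.1 hj).le⟩
  · ext ω
    constructor
    · rintro ⟨h1, h2⟩
      obtain ⟨n, rfl⟩ := hofReal ω h2.ne' h1
      exact ⟨ep.symm ⟨n, h2⟩, by simp⟩
    · rintro ⟨j, rfl⟩
      exact ⟨hspec _, hσ1 j⟩
  · refine Metric.tendsto_nhds.2 fun δ hδ => ?_
    rw [← Nat.cofinite_eq_atTop, Filter.eventually_cofinite]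
    refine ((hfin Ω δ hδ).preimage (f := fun j => (em j : κ'))
      (Subtype.val_injective.comp em.injective).injOn).subset fun j hj => ?_
    exact ⟨(hσ2 j).le, not_lt.1 hj⟩
  · ext ω
    constructor
    · rintro ⟨h1, h2⟩
      obtain ⟨n, rfl⟩ := hofReal ω h2.ne h1
      exact ⟨em.symm ⟨n, h2⟩, by simp⟩
    · rintro ⟨j, rfl⟩
      exact ⟨hspec _, hσ2 j⟩
  · rw [HilbertBasis.coe_mkOfOrthogonalEqBot, hHdef]
    refine ⟨fun j => hb _, fun j => hb _, fun i => ?_, fun hinj => ⟨fun i => ?_⟩⟩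
    · have h := hb (i : κ')
      rwa [show a i = Ω from i.2] at h
    · have h := hb (i : κ')
      rw [show a i = Ω from i.2, eigenspace_eq_bot_of_injective hinj, Submodule.mem_bot] at h
      exact b.orthonormal.ne_zero _ h

end Spectrum

/-! ### Multiplication operators and plane waves on the torus -/

section Torus

variable {d : ℕ} (v : Module.Basis (Fin d) ℝ (Space d))

lemma finite_norm_dualVector_add_le (k : Space d) (C : ℝ) :
    {n : Fin d → ℤ | ‖dualVector v n + k‖ ≤ C}.Finite := by
  -- The coefficients of a dual lattice vector are its pairings with the basis of the lattice.
  have hcoeff : ∀ (n : Fin d → ℤ) i, inner ℝ (dualVector v n) (v i) = 2 * Real.pi * n i := by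
    intro n i
    rw [inner_dualVector]
    congr 1
    rw [Finset.sum_eq_single i]
    · simp
    · intro j _ hj
      simp [Finsupp.single_eq_of_ne hj]
    · simp
  refine (Set.Finite.pi' fun i : Fin d =>
    Set.finite_Icc (-⌈(C + ‖k‖) * ‖v i‖⌉) ⌈(C + ‖k‖) * ‖v i‖⌉).subset fun n hn i => ?_
  have h1 : ‖dualVector v n‖ ≤ C + ‖k‖ := by
    have := norm_sub_le (dualVector v n + k) k
    rw [add_sub_cancel_right] at this
    exact this.trans (add_le_add hn.out le_rfl)
  have h2 := (abs_real_inner_le_norm (dualVector v n) (v i)).trans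
    (mul_le_mul_of_nonneg_right h1 (norm_nonneg _))
  rw [hcoeff, abs_mul, abs_of_pos Real.two_pi_pos] at h2
  have h3 : |(n i : ℝ)| ≤ (C + ‖k‖) * ‖v i‖ := by
    nlinarith [Real.pi_gt_three, abs_nonneg (n i : ℝ)]
  have h4 : |(n i : ℝ)| ≤ ⌈(C + ‖k‖) * ‖v i‖⌉ := h3.trans (Int.le_ceil _)
  exact abs_le.1 (by exact_mod_cast h4)

variable {v}

lemma torusMeasure_planeWave_eq {n : Fin d → ℤ} (hn : n ≠ 0) (ζ : ℂ) :
    torusMeasure v {t | planeWave v n t = ζ} = 0 := by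
  set f : Space d →ₗ[ℝ] ℝ := (innerSL ℝ (dualVector v n)).toLinearMap with hf
  have hfapp : ∀ x, f x = inner ℝ (dualVector v n) x := fun x => rfl
  obtain ⟨i, hi⟩ := Function.ne_iff.1 hn
  have hfi : f (v i) ≠ 0 := by
    rw [hfapp, inner_dualVector, Finset.sum_eq_single i]
    · simp only [Module.Basis.repr_self, Finsupp.single_eq_same, mul_one]
      exact mul_ne_zero Real.two_pi_pos.ne' (by exact_mod_cast hi)
    · intro j _ hj
      simp [Finsupp.single_eq_of_ne hj]
    · simp
  have hlevel : ∀ x₀, volume {x | f x = f x₀} = 0 := by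
    intro x₀
    have h1 : {x | f x = f x₀} = (AffineSubspace.mk' x₀ (LinearMap.ker f) : Set (Space d)) := by
      ext x
      simp [AffineSubspace.mem_mk', sub_eq_zero]
    rw [h1]
    refine Measure.addHaar_affineSubspace _ _ fun h => hfi ?_
    have h2 := congrArg AffineSubspace.direction h
    rw [AffineSubspace.direction_mk', AffineSubspace.direction_top] at h2
    exact LinearMap.mem_ker.1 (h2 ▸ Submodule.mem_top)
  have hlevel' : ∀ c, volume {x | f x = c} = 0 := by
    intro c
    by_cases h : ∃ x₀, f x₀ = c
    · obtain ⟨x₀, rfl⟩ := h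
      exact hlevel x₀
    · have : {x | f x = c} = ∅ := Set.eq_empty_of_forall_notMem fun x hx => h ⟨x, hx⟩
      rw [this, measure_empty]
  change torusMeasure v (planeWave v n ⁻¹' {ζ}) = 0
  rw [torusMeasure, Measure.map_apply (measurable_mk v)
    (measurable_planeWave v n (measurableSet_singleton ζ))]
  refine measure_mono_null ?_ (Measure.restrict_le_self.absolutelyContinuous
    (measure_iUnion_null fun m : ℤ => hlevel' (Complex.arg ζ + m * (2 * Real.pi))))
  intro x hx
  have hx : Complex.exp (Complex.I * (f x : ℝ)) = ζ := hx
  have hζ : Complex.exp (Complex.arg ζ * Complex.I) = ζ := by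
    have h1 : ‖ζ‖ = 1 := by rw [← hx, mul_comm, Complex.norm_exp_ofReal_mul_I]
    have h2 := Complex.norm_mul_exp_arg_mul_I ζ
    rwa [h1, Complex.ofReal_one, one_mul] at h2
  rw [← hζ, mul_comm, Complex.exp_eq_exp_iff_exists_int] at hx
  obtain ⟨m, hm⟩ := hx
  refine Set.mem_iUnion.2 ⟨m, ?_⟩
  have h3 : (f x : ℂ) * Complex.I =
      ((Complex.arg ζ + m * (2 * Real.pi) : ℝ) : ℂ) * Complex.I := by
    rw [hm]
    push_cast
    ring
  exact_mod_cast mul_right_cancel₀ Complex.I_ne_zero h3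

variable {ρ : Torus v → ℝ}

lemma isSymmetric_mulSqrt (hρ : MemLp ρ ∞ (torusMeasure v)) :
    (mulSqrt hρ : L2Torus v →ₗ[ℂ] L2Torus v).IsSymmetric := by
  intro φ ψ
  change inner ℂ (mulSqrt hρ φ) ψ = inner ℂ φ (mulSqrt hρ ψ)
  rw [L2.inner_def, L2.inner_def]
  refine integral_congr_ae ?_
  filter_upwards [coeFn_mulSqrt hρ φ, coeFn_mulSqrt hρ ψ] with t h1 h2
  rw [h1, h2, RCLike.inner_apply, RCLike.inner_apply, map_mul, Complex.conj_ofReal]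
  ring

lemma injective_mulSqrt (hρ : MemLp ρ ∞ (torusMeasure v))
    (hpos : ∀ᵐ t ∂(torusMeasure v), 0 < ρ t) : Function.Injective (mulSqrt hρ) := by
  rw [injective_iff_map_eq_zero]
  intro φ hφ
  rw [Lp.eq_zero_iff_ae_eq_zero] at hφ ⊢
  filter_upwards [hφ, coeFn_mulSqrt hρ φ, hpos] with t h1 h2 h3
  rw [h2] at h1
  refine (mul_eq_zero.1 h1).resolve_left ?_
  exact_mod_cast (Real.sqrt_pos.2 h3).ne'

/-- Multiplication by `√ρ` has infinite rank: a polynomial in a nonconstant plane wave that it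
annihilates vanishes on a set of positive measure, whereas the level sets of the plane wave are null
sets. -/
lemma not_finiteDimensional_quotient_ker_mulSqrt (hd : 1 ≤ d)
    (hρ : MemLp ρ ∞ (torusMeasure v)) (hρ_nonneg : ∀ᵐ t ∂(torusMeasure v), 0 ≤ ρ t)
    (hρ_ne : ¬ ∀ᵐ t ∂(torusMeasure v), ρ t = 0) {c : ℂ} (hc : c ≠ 0) :
    ¬ FiniteDimensional ℂ (L2Torus v ⧸
      LinearMap.ker ((c • mulSqrt hρ : L2Torus v →L[ℂ] L2Torus v) :
        L2Torus v →ₗ[ℂ] L2Torus v)) := by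
  intro hfin
  let n : Fin d → ℤ := fun _ => 1
  have hn : n ≠ 0 := fun h => one_ne_zero (congrFun h ⟨0, hd⟩)
  have hmem : ∀ p : Polynomial ℂ, MemLp (fun t => p.eval (planeWave v n t)) 2 (torusMeasure v) := by
    intro p
    obtain ⟨M, hM⟩ := (isCompact_sphere (0 : ℂ) 1).exists_bound_of_continuousOn p.continuousOn
    refine MemLp.of_bound
      (p.continuous.measurable.comp (measurable_planeWave v n)).aestronglyMeasurable M
      (.of_forall fun t => hM _ ?_)
    rw [mem_sphere_zero_iff_norm, norm_planeWave]
  let L : Polynomial ℂ →ₗ[ℂ] L2Torus v :=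
    { toFun := fun p => (hmem p).toLp _
      map_add' := fun p q => by
        rw [← MemLp.toLp_add]
        congr 1
        ext t
        simp
      map_smul' := fun z p => by
        rw [RingHom.id_apply, ← MemLp.toLp_const_smul]
        congr 1
        ext t
        simp }
  let F := (LinearMap.ker ((c • mulSqrt hρ : L2Torus v →L[ℂ] L2Torus v) :
    L2Torus v →ₗ[ℂ] L2Torus v)).mkQ ∘ₗ L
  have hF : Function.Injective F := by
    rw [injective_iff_map_eq_zero]
    intro p hp
    by_contra hp0
    have h1 : c • mulSqrt hρ (L p) = 0 := (Submodule.Quotient.mk_eq_zero _).1 hp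
    have h2 := (smul_eq_zero.1 h1).resolve_left hc
    rw [Lp.eq_zero_iff_ae_eq_zero] at h2
    have h3 : ∀ᵐ t ∂(torusMeasure v), ∀ ζ ∈ p.roots.toFinset, planeWave v n t ≠ ζ :=
      (Finset.eventually_all _).2 fun ζ _ => by
        rw [ae_iff]
        simpa using torusMeasure_planeWave_eq hn ζ
    refine hρ_ne ?_
    filter_upwards [h2, h3, hρ_nonneg, coeFn_mulSqrt hρ (L p), (hmem p).coeFn_toLp]
      with t h2 h3 h4 h5 h6
    have h7 : (L p : Torus v → ℂ) t = p.eval (planeWave v n t) := h6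
    rw [h5, h7] at h2
    rcases mul_eq_zero.1 h2 with h | h
    · exact (Real.sqrt_eq_zero h4).1 (by exact_mod_cast h)
    · exact absurd rfl (h3 _ (Multiset.mem_toFinset.2 ((Polynomial.mem_roots hp0).2 h)))
  have := FiniteDimensional.of_injective F hF
  exact Polynomial.not_finite (R := ℂ) this

end Torus

end Bloch

end

theorem theorem1 (d : ℕ) (hd : 1 ≤ d) (v : Module.Basis (Fin d) ℝ (Bloch.Space d))
    (ρ : Bloch.Torus v → ℝ) (hρ : MemLp ρ ∞ (Bloch.torusMeasure v))
    (hρ_nonneg : ∀ᵐ t ∂(Bloch.torusMeasure v), 0 ≤ ρ t)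
    (hρ_ne : ¬ ∀ᵐ t ∂(Bloch.torusMeasure v), ρ t = 0)
    (g Ω : ℝ) (hg : g ≠ 0) (k : Bloch.Space d) :
    (∀ z ∈ Bloch.spectrum (Bloch.blochHamiltonian v hρ g Ω k), z ≠ (Ω : ℂ) →
      z.im = 0 ∧ Bloch.IsDiscreteEigenvalue (Bloch.blochHamiltonian v hρ g Ω k) z) ∧
    ∃ ωp ωm : ℕ → ℝ,
      (Monotone ωp ∧ (∀ j, 0 ≤ ωp j) ∧ Filter.Tendsto ωp Filter.atTop Filter.atTop ∧
        {ω : ℝ | (ω : ℂ) ∈ Bloch.spectrum (Bloch.blochHamiltonian v hρ g Ω k) ∧ Ω < ω} =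
          Set.range ωp) ∧
      (Monotone ωm ∧ Filter.Tendsto ωm Filter.atTop (nhds Ω) ∧
        {ω : ℝ | (ω : ℂ) ∈ Bloch.spectrum (Bloch.blochHamiltonian v hρ g Ω k) ∧ ω < Ω} =
          Set.range ωm) ∧
      ∃ (ι : Type) (b : HilbertBasis (ℕ ⊕ ℕ ⊕ ι) ℂ (Bloch.L2TorusPair v)),
        (∀ j, b (Sum.inl j) ∈
          Bloch.eigenspace (Bloch.blochHamiltonian v hρ g Ω k) (ωp j : ℂ)) ∧
        (∀ j, b (Sum.inr (Sum.inl j)) ∈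
          Bloch.eigenspace (Bloch.blochHamiltonian v hρ g Ω k) (ωm j : ℂ)) ∧
        (∀ i, b (Sum.inr (Sum.inr i)) ∈
          Bloch.eigenspace (Bloch.blochHamiltonian v hρ g Ω k) (Ω : ℂ)) ∧
        ((∀ᵐ t ∂(Bloch.torusMeasure v), 0 < ρ t) → IsEmpty ι) := by
  have hg' : (g : ℂ) ≠ 0 := by exact_mod_cast hg
  have hα := Bloch.finite_norm_dualVector_add_le v k
  have hα' : ∀ C, ∃ n, C < ‖Bloch.dualVector v n + k‖ := by
    intro C
    have : Nonempty (Fin d) := ⟨⟨0, hd⟩⟩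
    by_contra! h
    exact Set.infinite_univ ((hα C).subset fun n _ => h n)
  have hB : (((g : ℂ) • Bloch.mulSqrt hρ : Bloch.L2Torus v →L[ℂ] Bloch.L2Torus v) :
      Bloch.L2Torus v →ₗ[ℂ] Bloch.L2Torus v).IsSymmetric := by
    intro φ ψ
    have h : inner ℂ (Bloch.mulSqrt hρ φ) ψ = inner ℂ φ (Bloch.mulSqrt hρ ψ) :=
      Bloch.isSymmetric_mulSqrt hρ φ ψ
    change inner ℂ ((g : ℂ) • Bloch.mulSqrt hρ φ) ψ = inner ℂ φ ((g : ℂ) • Bloch.mulSqrt hρ ψ)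
    rw [inner_smul_left, inner_smul_right, Complex.conj_ofReal, h]
  obtain ⟨h1, ωp, ωm, hp, hm, ι, b, hbp, hbm, hbΩ, hι⟩ :=
    Bloch.spectrum_coupledOperator (Bloch.planeWaveBasis v) (fun _ => norm_nonneg _) hα hα' hB
      (Bloch.not_finiteDimensional_quotient_ker_mulSqrt hd hρ hρ_nonneg hρ_ne hg') Ω
      (H := Bloch.blochHamiltonian v hρ g Ω k) rfl
  refine ⟨h1, ωp, ωm, hp, hm, ι, b, hbp, hbm, hbΩ, fun hpos => hι ?_⟩
  exact fun φ ψ h => Bloch.injective_mulSqrt hρ hpos (smul_right_injective _ hg' h)
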